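/- **Theorem (one-sided device-independent security of E-QKD).** Let $n,t,s,\ell$ be integers with $0<t,s,\ell<n$ and let $0\le\gamma<\frac12$. Write $h$ for the binary entropy function, $\log$ for the binary logarithm, $\beta_\circ=\frac12+\frac1{2\sqrt2}$, and $|x^\theta\rangle=H^{\theta_1}|x_1\rangle\otimes\cdots\otimes H^{\theta_n}|x_n\rangle$ for $x,\theta\in\{0,1\}^n$, where $H$ is the Hadamard matrix. *The protocol E-QKD.* Fix a syndrome function $S:\{0,1\}^{n-t}\to\{0,1\}^s$, a decoding procedure for Bob, and a finite universal$_2$ family $\mathcal F$ of hash functions $\{0,1\}^{n-t}\to\{0,1\}^\ell$ (that is, $\Pr_{F}[F(x)=F(x')]\le 2^{-\ell}$ for all $x\ne x'$ and $F$ uniformly random in $\mathcal F$). Alice prepares $n$ EPR pairs $\frac1{\sqrt2}(|00\rangle+|11\rangle)$, keeps one qubit of each and sends the other ones to Bob. Eve applies an arbitrary quantum channel from the $n$ transmitted qubits to a finite-dimensional system $BE$, where $B$ is the system of Bob's device and Eve keeps $E$; afterwards Bob's device and Eve do not communicate. Alice chooses a uniformly random $\Theta\in\{0,1\}^n$, announces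 it, and measures her qubits in the basis $\{|x^\Theta\rangle\}_x$ to obtain $X$; Bob's device produces $Y\in\{0,1\}^n$ by an arbitrary POVM $\{P^\Theta_y\}_y$ on $B$. Alice chooses a uniformly random $T\subset\{1,\dots,n\}$ of size $t$ and announces $T$ and $X_T$. If the relative Hamming distance of $X_T$ and $Y_T$ exceeds $\gamma$, the protocol aborts and $K=\perp$. Otherwise Alice announces $S(X_{T^c})$ and a uniformly random $F\in\mathcal F$; her key is $K=F(X_{T^c})$, and Bob's key is $\hat K=F(\hat X_{T^c})$, where $\hat X_{T^c}$ is obtained by decoding $Y_{T^c}$ with the syndrome. Let $E^+$ consist of $E$ and of everything announced, and let $\rho_{KE^+}$ be the final state. The protocol is *$\delta$-secure* if $$\Pr_\rho[K\ne\perp]\cdot\Delta\big(\rho_{KE^+|K\ne\perp},\ \mu_K\otimes\rho_{E^+|K\ne\perp}\big)\le\delta ,$$ where $\Delta(\rho,\sigma)=\max_{0\le M\le1}\mathrm{tr}(M(\rho-\sigma))$ is the trace distance and $\mu_K$ is the completely mixed state on the $2^\ell$ keys different from $\perp$. 1. For every $\varepsilon>0$ with $\gamma+\varepsilon\le\frac12$,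 every choice of $S$, decoding procedure and $\mathcal F$, every attack of Eve and every family of POVMs $\{P^\theta_y\}_y$ of Bob's device (an arbitrary, possibly malicious, measurement device), E-QKD is $\delta$-secure with $$\delta=5e^{-2\varepsilon^2t}+2^{-\frac12\left(\log(1/\beta_\circ)n-h(\gamma+\varepsilon)n-\ell-t-s+2\right)} .$$ 2. Asymptotically, noise up to about $1.5\%$ is tolerated: there is $\gamma_0\in(0.015,\,0.0155)$ such that, for $0\le\gamma<\frac12$, one has $2h(\gamma)<\log(1/\beta_\circ)$ if and only if $\gamma<\gamma_0$. Moreover, let $0\le\gamma<\gamma_0$ and let the syndrome lengths $s_n$ be positive for all large $n$ and approach the Shannon limit, $s_n/n\to h(\gamma)$. Then there are constants $\varepsilon>0$ with $\gamma+\varepsilon\le\frac12$ and $r>0$ and sequences $t_n,\ell_n$ of non-negative integers such that, for all large $n$, $0<t_n,s_n,\ell_n<n$ and $\ell_n\ge rn$ and E-QKD with parameters $n,t_n,s_n,\ell_n,\gamma$ is $\delta_n$-secure in the sense of 1., where $\delta_n$ is the value of the formula in 1. for these parameters and $\varepsilon$; and $\delta_n$ is negligible, i.e. $n^c\delta_n\to0$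 for every $c\in\mathbb N$. -/

import Mathlib

open Matrix Filter Topology
open scoped Kronecker ComplexOrder

noncomputable section

namespace EQKD

/-! ### Finite-dimensional quantum states, measurements and trace distance

Operators on the Hilbert space `ℂ^H` (for a finite index type `H`) are complex `H × H` matrices, and
`ℂ^G ⊗ ℂ^H` is `ℂ^(G × H)`. -/

/-- A POVM with outcomes in `X` on the Hilbert space `ℂ^H`. -/
structure POVM (X H : Type) [Fintype X] [Fintype H] [DecidableEq H] where
  op : X → Matrix H H ℂ
  posSemidef : ∀ x, (op x).PosSemidef
  sum_eq_one : ∑ x, op x = 1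

/-- The partial trace over the first tensor factor. -/
def traceFst {G H : Type} [Fintype G] (M : Matrix (G × H) (G × H) ℂ) : Matrix H H ℂ :=
  Matrix.of fun i j => ∑ g, M (g, i) (g, j)

/-- The trace distance `Δ(ρ, σ) = max_{0 ≤ M ≤ 1} tr (M (ρ - σ))`. -/
def traceDist {H : Type} [Fintype H] [DecidableEq H] (ρ σ : Matrix H H ℂ) : ℝ :=
  sSup {r : ℝ | ∃ M : Matrix H H ℂ, M.PosSemidef ∧ (1 - M).PosSemidef ∧
    r = (M * (ρ - σ)).trace.re}

section Conditioning

variable {K H : Type} [Fintype K] [DecidableEq K] [Fintype H] [DecidableEq H]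

/-- The operator `∑_k λ(k) |k⟩⟨k| ⊗ 1` of the event that the classical register `K` satisfies the
predicate `lam`. -/
def eventProj (lam : K → Prop) [DecidablePred lam] : Matrix (K × H) (K × H) ℂ :=
  Matrix.diagonal (fun k => if lam k then (1 : ℂ) else 0) ⊗ₖ (1 : Matrix H H ℂ)

/-- The probability of the event `lam` of the classical register `K` in the state `ρ`. -/
def prob (ρ : Matrix (K × H) (K × H) ℂ) (lam : K → Prop) [DecidablePred lam] : ℝ :=
  (eventProj lam * ρ).trace.re

/-- The CQ state `ρ` conditioned on the event `lam` of its classical register `K`. -/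
def condState (ρ : Matrix (K × H) (K × H) ℂ) (lam : K → Prop) [DecidablePred lam] :
    Matrix (K × H) (K × H) ℂ :=
  ((prob ρ lam : ℂ)⁻¹) • (eventProj lam * ρ * eventProj lam)

end Conditioning

/-! ### Bit strings, BB84 bases and EPR pairs -/

/-- Bit strings of length `n`; this also indexes the computational basis of `n` qubits. -/
abbrev Bits (n : ℕ) : Type := Fin n → Bool

/-- The relative Hamming distance. -/
def relDist {n : ℕ} (x y : Bits n) : ℝ := (hammingDist x y : ℝ) / n

/-- The Hadamard matrix. -/
def hadamardGate : Matrix Bool Bool ℂ :=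
  Matrix.of fun a b => ((Real.sqrt 2 : ℝ) : ℂ)⁻¹ * (if a && b then -1 else 1)

/-- The vector `|x^θ⟩ = H^{θ₁}|x₁⟩ ⊗ ⋯ ⊗ H^{θₙ}|xₙ⟩`. -/
def bb84Vec {n : ℕ} (θ x : Bits n) : Bits n → ℂ := fun z =>
  ∏ i, (if θ i then hadamardGate else 1) (z i) (x i)

/-- Alice's measurement operator `|x^θ⟩⟨x^θ|`. -/
def bb84Proj {n : ℕ} (θ x : Bits n) : Matrix (Bits n) (Bits n) ℂ :=
  Matrix.vecMulVec (bb84Vec θ x) (star (bb84Vec θ x))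

/-- The state vector of `n` EPR pairs `(|00⟩ + |11⟩)/√2`; the first component collects Alice's
qubits and the second one the qubits that she sends. -/
def eprVec (n : ℕ) : Bits n × Bits n → ℂ := fun p =>
  ∏ i, if p.1 i = p.2 i then ((Real.sqrt 2 : ℝ) : ℂ)⁻¹ else 0

/-- The density operator of `n` EPR pairs. -/
def eprState (n : ℕ) : Matrix (Bits n × Bits n) (Bits n × Bits n) ℂ :=
  Matrix.vecMulVec (eprVec n) (star (eprVec n))

/-! ### The protocol -/

/-- Eve's attack on the `n` qubits in transit: an arbitrary quantum channel (completely positive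
trace-preserving map, in Kraus form) into the joint system of Bob's device `B` and of Eve `E`. -/
structure Attack (n : ℕ) (B E : Type) [Fintype B] [Fintype E] where
  rank : ℕ
  kraus : Fin rank → Matrix (B × E) (Bits n) ℂ
  trace_preserving : ∑ j, (kraus j)ᴴ * kraus j = 1

/-- The state of Alice, Bob's device and Eve after the state preparation and the attack. -/
def Attack.state {n : ℕ} {B E : Type} [Fintype B] [Fintype E] (A : Attack n B E) :
    Matrix (Bits n × (B × E)) (Bits n × (B × E)) ℂ :=
  ∑ j, ((1 : Matrix (Bits n) (Bits n) ℂ) ⊗ₖ A.kraus j) * eprState n *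
    ((1 : Matrix (Bits n) (Bits n) ℂ) ⊗ₖ A.kraus j)ᴴ

/-- The subsets of `{1, …, n}` of size `t`. -/
abbrev Sample (n t : ℕ) : Type := {T : Finset (Fin n) // T.card = t}

lemma Sample.card_compl {n t : ℕ} (T : Sample n t) : (T.1ᶜ).card = n - t := by
  rw [Finset.card_compl, T.2, Fintype.card_fin]

/-- The restriction `x_T`, listed in increasing order of positions. -/
def onSample {n t : ℕ} (T : Sample n t) (x : Bits n) : Bits t :=
  fun i => x (T.1.orderEmbOfFin T.2 i)

/-- The restriction `x_{Tᶜ}`, listed in increasing order of positions. -/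
def offSample {n t : ℕ} (T : Sample n t) (x : Bits n) : Bits (n - t) :=
  fun i => x ((T.1ᶜ).orderEmbOfFin T.card_compl i)

/-- The classical post-processing: a syndrome function, Bob's error correction procedure (from the
syndrome and his string), and a family of hash functions indexed by `ι`. -/
structure PostProcessing (n t s l : ℕ) (ι : Type) where
  syndrome : Bits (n - t) → Bits s
  correct : Bits s → Bits (n - t) → Bits (n - t)
  hash : ι → Bits (n - t) → Bits l

/-- A family of hash functions is universal₂ if any two distinct inputs collide with probability at
most `2^{-l}` under a uniformly random member of the family. -/
def IsUniversalTwo {m l : ℕ} {ι : Type} [Fintype ι] (F : ι → Bits m → Bits l) : Prop :=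
  ∀ x x' : Bits m, x ≠ x' →
    (Nat.card {f : ι // F f x = F f x'} : ℝ) / (Fintype.card ι : ℝ) ≤ 1 / 2 ^ l

/-- The classical information that is sent publicly: the bases `Θ`, the sample `T`, the bits `X_T`,
and, unless the protocol is aborted (`none`), the syndrome and the hash function. -/
abbrev Transcript (n t s : ℕ) (ι : Type) : Type :=
  (Bits n × Sample n t) × (Bits t × Option (Bits s × ι))

instance {n t s : ℕ} {ι : Type} [DecidableEq ι] : DecidableEq (Transcript n t s ι) :=
  @instDecidableEqProd _ _ inferInstance inferInstance

section Execution

variable {n t s l : ℕ} {ι : Type}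

/-- The public transcript, if the random choices are `θ`, `T`, `f` and Alice and Bob measure `x` and
`y`. The protocol is aborted if the relative Hamming distance on the sample exceeds `γ`. -/
def transcript (γ : ℝ) (C : PostProcessing n t s l ι) (θ : Bits n) (T : Sample n t) (f : ι)
    (x y : Bits n) : Transcript n t s ι :=
  ((θ, T), (onSample T x,
    if γ < relDist (onSample T x) (onSample T y) then none
    else some (C.syndrome (offSample T x), f)))

/-- Alice's key; `none` stands for `⊥`. -/
def aliceKey (γ : ℝ) (C : PostProcessing n t s l ι) (T : Sample n t) (f : ι) (x y : Bits n) :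
    Option (Bits l) :=
  if γ < relDist (onSample T x) (onSample T y) then none
  else some (C.hash f (offSample T x))

/-- Bob's key; `none` stands for `⊥`. -/
def bobKey (γ : ℝ) (C : PostProcessing n t s l ι) (T : Sample n t) (f : ι) (x y : Bits n) :
    Option (Bits l) :=
  if γ < relDist (onSample T x) (onSample T y) then none
  else some (C.hash f (C.correct (C.syndrome (offSample T x)) (offSample T y)))

variable {B E : Type} [Fintype B] [DecidableEq B] [Fintype E] [DecidableEq E]

/-- Eve's (unnormalized) state when Alice and Bob's device measure in basis `θ` with outcomes `x` and
`y`; its trace is the probability of these outcomes. Bob's device applies the arbitrary POVM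
`P θ` to its system. -/
def eveState (A : Attack n B E) (P : Bits n → POVM (Bits n) B) (θ x y : Bits n) :
    Matrix E E ℂ :=
  traceFst (traceFst ((bb84Proj θ x ⊗ₖ ((P θ).op y ⊗ₖ (1 : Matrix E E ℂ))) * A.state))

variable [Fintype ι] [DecidableEq ι]

/-- The final state of Bob's key, Alice's key, the public transcript and Eve's quantum system:
`∑ p(θ) p(T) p(f) |k̂⟩⟨k̂| ⊗ |k⟩⟨k| ⊗ |c⟩⟨c| ⊗ ρ_E^{θ,x,y}` with uniformly random `θ`, `T`, `f`. -/
def finalState (γ : ℝ) (C : PostProcessing n t s l ι) (A : Attack n B E)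
    (P : Bits n → POVM (Bits n) B) :
    Matrix (Option (Bits l) × Option (Bits l) × Transcript n t s ι × E)
      (Option (Bits l) × Option (Bits l) × Transcript n t s ι × E) ℂ :=
  ∑ θ : Bits n, ∑ T : Sample n t, ∑ f : ι, ∑ x : Bits n, ∑ y : Bits n,
    ((Fintype.card (Bits n) : ℂ)⁻¹ * (Fintype.card (Sample n t) : ℂ)⁻¹ *
        (Fintype.card ι : ℂ)⁻¹) •
      (Matrix.single (bobKey γ C T f x y) (bobKey γ C T f x y) (1 : ℂ) ⊗ₖ
        (Matrix.single (aliceKey γ C T f x y) (aliceKey γ C T f x y) (1 : ℂ) ⊗ₖ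
          (Matrix.single (transcript γ C θ T f x y) (transcript γ C θ T f x y) (1 : ℂ) ⊗ₖ
            eveState A P θ x y)))

/-- The final state `ρ_{K E⁺}` of Alice's key `K` and of all of Eve's classical and quantum
information `E⁺`. -/
def keyEveState (γ : ℝ) (C : PostProcessing n t s l ι) (A : Attack n B E)
    (P : Bits n → POVM (Bits n) B) :
    Matrix (Option (Bits l) × Transcript n t s ι × E)
      (Option (Bits l) × Transcript n t s ι × E) ℂ :=
  traceFst (finalState γ C A P)

end Execution

/-! ### Security -/

/-- The completely mixed state `μ_K` on the `2^l`-dimensional space of keys different from `⊥`. -/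
def uniformKey (l : ℕ) : Matrix (Option (Bits l)) (Option (Bits l)) ℂ :=
  Matrix.diagonal fun k => if k = none then 0 else ((2 : ℂ) ^ l)⁻¹

/-- `ρ_{K E⁺}` satisfies
`Pr[K ≠ ⊥] · Δ(ρ_{K E⁺ | K ≠ ⊥}, μ_K ⊗ ρ_{E⁺ | K ≠ ⊥}) ≤ δ`. -/
def IsDeltaSecure {l : ℕ} {H : Type} [Fintype H] [DecidableEq H]
    (ρ : Matrix (Option (Bits l) × H) (Option (Bits l) × H) ℂ) (δ : ℝ) : Prop :=
  prob ρ (fun k => k ≠ none) *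
    traceDist (condState ρ fun k => k ≠ none)
      (uniformKey l ⊗ₖ traceFst (condState ρ fun k => k ≠ none)) ≤ δ

/-- The protocol with parameters `n, t, s, l, γ` is `δ`-secure with an arbitrary measurement device
for Bob: for every syndrome function, error correction procedure and universal₂ hash family, every
attack of Eve on the transmitted qubits and every family of POVMs of Bob's device. -/
def OneSidedSecure (n t s l : ℕ) (γ δ : ℝ) : Prop :=
  ∀ (ι : Type) [Fintype ι] [DecidableEq ι] [Nonempty ι] (C : PostProcessing n t s l ι),
    IsUniversalTwo C.hash →
    ∀ (B E : Type) [Fintype B] [DecidableEq B] [Fintype E] [DecidableEq E]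
      (A : Attack n B E) (P : Bits n → POVM (Bits n) B),
      IsDeltaSecure (keyEveState γ C A P) δ

/-- The binary entropy function, in bits. -/
def binEnt (p : ℝ) : ℝ := Real.binEntropy p / Real.log 2

/-- `β₀ = 1/2 + 1/(2√2)`. -/
def betaZero : ℝ := 1 / 2 + 1 / (2 * Real.sqrt 2)

/-- The security error
`5 e^{-2ε²t} + 2^{-(1/2)(log(1/β₀) n - h(γ+ε) n - l - t - s + 2)}`. -/
def errorBound (n t s l : ℕ) (γ ε : ℝ) : ℝ :=
  5 * Real.exp (-2 * ε ^ 2 * t) +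
    (2 : ℝ) ^ (-(1 / 2 : ℝ) *
      (Real.logb 2 (1 / betaZero) * n - binEnt (γ + ε) * n - l - t - s + 2))

end EQKD

end

/-!
The final state is split according to whether the strings `x` of Alice and `y` of Bob's device
differ in at most a fraction `γ + ε` of *all* positions.

If they differ in more, the test on the random sample rarely accepts. The moment generating function
of a hypergeometric variable is dominated by the binomial one, so Hoeffding's bound
`e^{-2ε²t}` holds for sampling without replacement (`card_accepted_le`).

If they are close, Eve's ability to guess `x` is limited by a monogamy-of-entanglement game
(`sum_trace_mul_eveState_le`): Bob's device and Eve, both told the basis `θ`, cannot both guess `x`.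
Up to a union bound over the at most `2^{h(γ+ε)n}` error strings (`card_hammingBall_le`), Bob's
guess may be taken to be perfect. The winning probability is then, after averaging over `θ`,
controlled by the overlaps of the operators of the games for two bases `θ`, `θ'`. Keeping only Bob's
guess for one basis and only Eve's for the other bounds such an overlap by the maximal overlap
`2^{-|θ ⊕ θ'|/2}` of basis vectors (`sum_overlap_le`), and a Schur test turns these numbers into the bound
`2^{-n} ∑_k C(n,k) 2^{-k/2} = β₀ⁿ` (`sum_game_le`). The operators of Bob and Eve only need to
commute, and no dilation to projective measurements is necessary.

A small guessing probability yields a key by privacy amplification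
(`exists_subPOVM_sum_trace_le`). The collision probability in the left-over hash lemma, weighted by
Eve's average state `τ`, equals the success probability of the pretty good measurement
`τ^{-1/2} ω_x τ^{-1/2}`, which is one of the measurements covered by the monogamy game; the dual
description of the min-entropy is not needed. The published bits `x_T` and the syndrome raise the
guessing probability by at most `2^{t+s}` (`privacy_amplification`). The two parts add up to
`e^{-2ε²t} + ½ √(2^{l+t+s} 2^{h(γ+ε)n} β₀ⁿ)`, which is below the stated error
(`oneSidedSecure_errorBound`).

The asymptotic statement follows from continuity and strict monotonicity of the binary entropy on
`[0, 1/2]`, with the threshold located by rational bounds on `1/β₀ = 4 - 2√2`.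
-/

noncomputable section

namespace EQKD

/-! ### Sampling without replacement -/

lemma choose_mul_pow_le_choose_mul_pow {m n : ℕ} (h : m ≤ n) (j : ℕ) :
    m.choose j * n ^ j ≤ n.choose j * m ^ j := by
  induction j with
  | zero => simp
  | succ j ih =>
    have h1 := Nat.choose_succ_right_eq m j
    have h2 := Nat.choose_succ_right_eq n j
    have h3 : (m - j) * n ≤ (n - j) * m := by
      rw [Nat.sub_mul, Nat.sub_mul, Nat.mul_comm m n]
      exact Nat.sub_le_sub_left (Nat.mul_le_mul_left j h) _
    refine Nat.le_of_mul_le_mul_right (c := j + 1) ?_ (Nat.succ_pos j)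
    calc m.choose (j + 1) * n ^ (j + 1) * (j + 1)
        = (m.choose (j + 1) * (j + 1)) * n * n ^ j := by ring
      _ = (m.choose j * n ^ j) * ((m - j) * n) := by rw [h1]; ring
      _ ≤ (n.choose j * m ^ j) * ((n - j) * m) := Nat.mul_le_mul ih h3
      _ = (n.choose j * (n - j)) * m * m ^ j := by ring
      _ = n.choose (j + 1) * m ^ (j + 1) * (j + 1) := by rw [← h2]; ring

lemma card_filter_subset_powersetCard {α : Type*} [Fintype α] [DecidableEq α] (J : Finset α)
    (t : ℕ) (h : J.card ≤ t) :
    (((Finset.univ : Finset α).powersetCard t).filter (J ⊆ ·)).card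
      = (Fintype.card α - J.card).choose (t - J.card) := by
  rw [← Finset.card_compl, ← Finset.card_powersetCard]
  refine Finset.card_bij' (fun T _ => T \ J) (fun S _ => S ∪ J) ?_ ?_ ?_ ?_
  · intro T hT
    simp only [Finset.mem_filter, Finset.mem_powersetCard, Finset.subset_univ, true_and] at hT
    rw [Finset.mem_powersetCard, Finset.card_sdiff_of_subset hT.2, hT.1]
    refine ⟨?_, rfl⟩
    intro i hi
    simp only [Finset.mem_sdiff] at hi
    simpa using hi.2
  · intro S hS
    rw [Finset.mem_powersetCard] at hS
    have hd : Disjoint S J := by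
      rw [Finset.disjoint_left]
      intro i hi
      simpa using hS.1 hi
    simp only [Finset.mem_filter, Finset.mem_powersetCard, Finset.subset_univ, true_and,
      Finset.card_union_of_disjoint hd, hS.2, Finset.subset_union_right, and_true]
    omega
  · intro T hT
    simp only [Finset.mem_filter] at hT
    exact Finset.sdiff_union_of_subset hT.2
  · intro S hS
    rw [Finset.mem_powersetCard] at hS
    have hd : Disjoint S J := by
      rw [Finset.disjoint_left]
      intro i hi
      simpa using hS.1 hi
    rw [Finset.union_sdiff_right, Finset.sdiff_eq_self_of_disjoint hd]

/-- The moment generating function of the hypergeometric distribution is at most the one of the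
binomial distribution with the same mean, at arguments `≥ 1`. Expanding `(1 + b) ^ #(T ∩ G)` over
the subsets of `T ∩ G` makes this a termwise comparison of binomial moments. -/
lemma sum_powersetCard_pow_card_inter_le {n t : ℕ} (hn : 0 < n) (htn : t ≤ n)
    (G : Finset (Fin n)) {b : ℝ} (hb : 0 ≤ b) :
    ∑ T ∈ (Finset.univ : Finset (Fin n)).powersetCard t, (1 + b) ^ (T ∩ G).card
      ≤ n.choose t * (1 + b * (G.card / n)) ^ t := by
  have hn' : (0 : ℝ) < n := by exact_mod_cast hn
  have hGn : G.card ≤ n := by simpa using Finset.card_le_univ G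
  set N : ℕ → ℝ := fun j => if j ≤ t then ((n - j).choose (t - j) : ℝ) else 0 with hN
  have hcount : ∀ J : Finset (Fin n),
      ((((Finset.univ : Finset (Fin n)).powersetCard t).filter (J ⊆ ·)).card : ℝ) = N J.card := by
    intro J
    by_cases hJ : J.card ≤ t
    · rw [card_filter_subset_powersetCard J t hJ]
      simp [hN, hJ]
    · simp only [hN, hJ, if_false, Nat.cast_eq_zero, Finset.card_eq_zero,
        Finset.filter_eq_empty_iff, Finset.mem_powersetCard, Finset.subset_univ, true_and]
      intro T hT hJT
      exact hJ (hT ▸ Finset.card_le_card hJT)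
  calc ∑ T ∈ (Finset.univ : Finset (Fin n)).powersetCard t, (1 + b) ^ (T ∩ G).card
      = ∑ T ∈ (Finset.univ : Finset (Fin n)).powersetCard t,
          ∑ J ∈ G.powerset, if J ⊆ T then b ^ J.card else 0 := by
        refine Finset.sum_congr rfl fun T _ => ?_
        rw [add_comm, ← Finset.sum_pow_mul_eq_add_pow, ← Finset.sum_filter]
        refine Finset.sum_congr ?_ fun J _ => by simp
        ext J
        simp only [Finset.mem_powerset, Finset.mem_filter, Finset.subset_inter_iff]
        tauto
    _ = ∑ J ∈ G.powerset, b ^ J.card * N J.card := by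
        rw [Finset.sum_comm]
        refine Finset.sum_congr rfl fun J _ => ?_
        rw [← Finset.sum_filter, Finset.sum_const, nsmul_eq_mul, hcount, mul_comm]
    _ = ∑ j ∈ Finset.range (G.card + 1), (G.card.choose j : ℝ) * (b ^ j * N j) := by
        rw [Finset.sum_powerset_apply_card (fun j => b ^ j * N j)]
        simp
    _ ≤ ∑ j ∈ Finset.range (n + 1), (G.card.choose j : ℝ) * (b ^ j * N j) := by
        refine Finset.sum_le_sum_of_subset_of_nonneg
          (Finset.range_subset_range.2 (by omega)) fun j _ _ => ?_
        have : 0 ≤ N j := by simp only [hN]; split_ifs <;> positivity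
        positivity
    _ = ∑ j ∈ Finset.range (t + 1), (G.card.choose j : ℝ) * (b ^ j * N j) := by
        symm
        refine Finset.sum_subset (Finset.range_subset_range.2 (by omega)) fun j _ hj => ?_
        have : ¬ j ≤ t := by simpa [Nat.lt_succ_iff] using hj
        simp [hN, this]
    _ ≤ ∑ j ∈ Finset.range (t + 1),
          n.choose t * ((b * (G.card / n)) ^ j * 1 ^ (t - j) * (t.choose j : ℝ)) := by
        refine Finset.sum_le_sum fun j hj => ?_
        have hjt : j ≤ t := by simpa [Nat.lt_succ_iff] using hj
        have hpos : (0 : ℝ) < n.choose j := by exact_mod_cast Nat.choose_pos (hjt.trans htn)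
        have h1 : (G.card.choose j : ℝ) * (n : ℝ) ^ j ≤ n.choose j * (G.card : ℝ) ^ j := by
          exact_mod_cast choose_mul_pow_le_choose_mul_pow hGn j
        have h2 : (n.choose t : ℝ) * t.choose j = n.choose j * (n - j).choose (t - j) := by
          exact_mod_cast Nat.choose_mul hjt
        have h3 : (G.card.choose j : ℝ) ≤ n.choose j * ((G.card : ℝ) / n) ^ j := by
          rw [div_pow, ← mul_div_assoc, le_div_iff₀ (by positivity)]
          exact h1
        simp only [hN, hjt, if_true, one_pow, mul_one, mul_pow]
        calc (G.card.choose j : ℝ) * (b ^ j * (n - j).choose (t - j))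
            ≤ (n.choose j * ((G.card : ℝ) / n) ^ j) * (b ^ j * (n - j).choose (t - j)) := by
              gcongr
          _ = (n.choose j * (n - j).choose (t - j)) * (b ^ j * ((G.card : ℝ) / n) ^ j) := by ring
          _ = n.choose t * (b ^ j * ((G.card : ℝ) / n) ^ j * t.choose j) := by rw [← h2]; ring
    _ = n.choose t * (1 + b * (G.card / n)) ^ t := by
        rw [← Finset.mul_sum, ← add_pow, add_comm]

/-- Hoeffding's lemma for a Bernoulli variable. -/
lemma one_add_mul_exp_sub_one_le (p : ℝ) (hp0 : 0 ≤ p) (hp1 : p ≤ 1) (r : ℝ) :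
    1 + (Real.exp r - 1) * p ≤ Real.exp (r * p + r ^ 2 / 8) := by
  let μ : MeasureTheory.Measure ℝ :=
    ENNReal.ofReal (1 - p) • MeasureTheory.Measure.dirac 0
      + ENNReal.ofReal p • MeasureTheory.Measure.dirac 1
  have hμ : MeasureTheory.IsProbabilityMeasure μ := by
    constructor
    simp only [μ, MeasureTheory.Measure.add_apply, MeasureTheory.Measure.smul_apply,
      MeasureTheory.measure_univ, smul_eq_mul, mul_one]
    rw [← ENNReal.ofReal_add (by linarith) hp0]
    simp
  have hint : ∀ f : ℝ → ℝ, ∫ x, f x ∂μ = (1 - p) * f 0 + p * f 1 := by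
    intro f
    have hd : ∀ a : ℝ, MeasureTheory.Integrable f (MeasureTheory.Measure.dirac a) := fun a =>
      MeasureTheory.integrable_dirac (by simp)
    rw [MeasureTheory.integral_add_measure ((hd 0).smul_measure ENNReal.ofReal_ne_top)
      ((hd 1).smul_measure ENNReal.ofReal_ne_top)]
    simp [MeasureTheory.integral_smul_measure, ENNReal.toReal_ofReal, hp0, hp1]
  have hae : ∀ᵐ x ∂μ, (id x : ℝ) ∈ Set.Icc (0 : ℝ) 1 := by
    rw [MeasureTheory.ae_add_measure_iff]
    constructor
    · refine MeasureTheory.Measure.ae_smul_measure ?_ _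
      simp [MeasureTheory.ae_dirac_eq]
    · refine MeasureTheory.Measure.ae_smul_measure ?_ _
      simp [MeasureTheory.ae_dirac_eq]
  have h := (ProbabilityTheory.hasSubgaussianMGF_of_mem_Icc aemeasurable_id hae).mgf_le r
  rw [ProbabilityTheory.mgf, hint, hint] at h
  simp only [id, mul_zero, mul_one, zero_add, zero_sub, sub_zero, nnnorm_one] at h
  have h2 : Real.exp (r * p + r ^ 2 / 8) = Real.exp (r * p) * Real.exp (r ^ 2 / 8) :=
    Real.exp_add _ _
  have h3 : ((((1 : NNReal) / 2) ^ 2 : NNReal) : ℝ) * r ^ 2 / 2 = r ^ 2 / 8 := by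
    push_cast; ring
  rw [h3] at h
  rw [h2]
  calc 1 + (Real.exp r - 1) * p
      = Real.exp (r * p) *
          ((1 - p) * Real.exp (r * -p) + p * Real.exp (r * (1 - p))) := by
        have e1 : Real.exp (r * p) * Real.exp (r * -p) = 1 := by
          rw [← Real.exp_add]; simp
        have e2 : Real.exp (r * p) * Real.exp (r * (1 - p)) = Real.exp r := by
          rw [← Real.exp_add]; ring_nf
        linear_combination (-(1 - p)) * e1 - p * e2
    _ ≤ _ := by gcongr

/-- Hoeffding's bound for sampling without replacement: a uniformly random sample of size `t` rarely
contains at most a fraction `γ` of elements of a set that makes up more than a fraction `γ + ε` of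
the whole population. -/
lemma card_filter_inter_card_le {n t : ℕ} (hn : 0 < n) (htn : t ≤ n)
    (D : Finset (Fin n)) {γ ε : ℝ} (hε : 0 < ε) (hD : γ + ε < (D.card : ℝ) / n) :
    ((((Finset.univ : Finset (Fin n)).powersetCard t).filter
        fun T => ((T ∩ D).card : ℝ) ≤ γ * t).card : ℝ)
      ≤ n.choose t * Real.exp (-2 * ε ^ 2 * t) := by
  have hn' : (0 : ℝ) < n := by exact_mod_cast hn
  set g : ℝ := ((Dᶜ).card : ℝ) / n with hg
  have hgD : g = 1 - (D.card : ℝ) / n := by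
    rw [hg, Finset.card_compl, Fintype.card_fin,
      Nat.cast_sub (by simpa using Finset.card_le_univ D)]
    field_simp
  have hg0 : 0 ≤ g := by positivity
  have hg1 : g ≤ 1 := by rw [hgD]; linarith [show (0:ℝ) ≤ (D.card : ℝ) / n by positivity]
  have hr : (0 : ℝ) ≤ 4 * ε := by linarith
  -- Chernoff's method for the complement of `D`; `r = 4 ε` minimizes `-r ε + r ^ 2 / 8`
  have hb : 0 ≤ Real.exp (4 * ε) - 1 := by linarith [Real.add_one_le_exp (4 * ε)]
  have key := sum_powersetCard_pow_card_inter_le hn htn Dᶜ hb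
  rw [← hg] at key
  have hE : (1 + (Real.exp (4 * ε) - 1)) = Real.exp (4 * ε) := by ring
  simp only [hE] at key
  have hlow : ((((Finset.univ : Finset (Fin n)).powersetCard t).filter
        fun T => ((T ∩ D).card : ℝ) ≤ γ * t).card : ℝ) * Real.exp (4 * ε * ((1 - γ) * t))
      ≤ ∑ T ∈ (Finset.univ : Finset (Fin n)).powersetCard t,
          Real.exp (4 * ε) ^ (T ∩ Dᶜ).card := by
    rw [← nsmul_eq_mul, ← Finset.sum_const, Finset.sum_filter]
    refine Finset.sum_le_sum fun T hT => ?_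
    split_ifs with h
    · rw [← Real.exp_nat_mul, Real.exp_le_exp]
      have hT' : T.card = t := (Finset.mem_powersetCard.1 hT).2
      have hc : ((T ∩ D).card : ℝ) + (T ∩ Dᶜ).card = t := by
        rw [← hT', ← Nat.cast_add, ← Finset.sdiff_eq_inter_compl, Finset.card_inter_add_card_sdiff]
      nlinarith
    · positivity
  have hup : (1 + (Real.exp (4 * ε) - 1) * g) ^ t
      ≤ Real.exp (t * (4 * ε * g + (4 * ε) ^ 2 / 8)) := by
    rw [Real.exp_nat_mul]
    exact pow_le_pow_left₀ (by positivity) (one_add_mul_exp_sub_one_le g hg0 hg1 _) t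
  have hexp : Real.exp (t * (4 * ε * g + (4 * ε) ^ 2 / 8))
      ≤ Real.exp (-2 * ε ^ 2 * t) * Real.exp (4 * ε * ((1 - γ) * t)) := by
    rw [← Real.exp_add, Real.exp_le_exp]
    have : g ≤ 1 - γ - ε := by linarith
    have h4 : (t : ℝ) * (4 * ε * g) ≤ t * (4 * ε * (1 - γ - ε)) := by gcongr
    nlinarith
  refine le_of_mul_le_mul_right ?_ (Real.exp_pos (4 * ε * ((1 - γ) * t)))
  calc _ ≤ _ := hlow
    _ ≤ _ := key
    _ ≤ n.choose t * (Real.exp (-2 * ε ^ 2 * t) * Real.exp (4 * ε * ((1 - γ) * t))) := by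
      gcongr
      exact hup.trans hexp
    _ = _ := by ring

/-! ### The volume of Hamming balls -/

lemma sum_bits_prod_eq_prod_sum {n : ℕ} {R : Type*} [CommSemiring R] (f : Fin n → Bool → R) :
    ∑ a : Bits n, ∏ i, f i (a i) = ∏ i, (f i true + f i false) := by
  have h := Finset.prod_univ_sum (fun _ : Fin n => (Finset.univ : Finset Bool)) f
  simp only [Fintype.piFinset_univ] at h
  rw [← h]
  simp

lemma prod_ite_eq_pow_card {n : ℕ} (e : Bits n) (r : ℝ) :
    ∏ i, (if e i then r else 1) = r ^ (Finset.univ.filter fun i => e i = true).card := by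
  rw [Finset.prod_ite]
  simp

/-- A Hamming ball of relative radius `q ≤ 1/2` has at most `2 ^ (h(q) n)` elements: every string in
it has weight at least one under `e ↦ (q / (1 - q)) ^ (|e| - q n)`. -/
lemma card_hammingBall_le (n : ℕ) {q : ℝ} (hq0 : 0 < q) (hq1 : q ≤ 1 / 2) :
    ((Finset.univ.filter fun e : Bits n =>
        ((Finset.univ.filter fun i => e i = true).card : ℝ) ≤ q * n).card : ℝ)
      ≤ (2 : ℝ) ^ (binEnt q * n) := by
  have h1q : 0 < 1 - q := by linarith
  have hr0 : 0 < q / (1 - q) := by positivity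
  have hr1 : q / (1 - q) ≤ 1 := by rw [div_le_one h1q]; linarith
  have hlow : ((Finset.univ.filter fun e : Bits n =>
        ((Finset.univ.filter fun i => e i = true).card : ℝ) ≤ q * n).card : ℝ)
        * (q / (1 - q)) ^ (q * n)
      ≤ ∑ e : Bits n, ∏ i, (if e i then q / (1 - q) else 1) := by
    rw [← nsmul_eq_mul, ← Finset.sum_const, Finset.sum_filter]
    refine Finset.sum_le_sum fun e _ => ?_
    rw [prod_ite_eq_pow_card]
    split_ifs with h
    · rw [← Real.rpow_natCast]
      exact Real.rpow_le_rpow_of_exponent_ge hr0 hr1 h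
    · positivity
  rw [sum_bits_prod_eq_prod_sum fun _ b => if b then q / (1 - q) else 1] at hlow
  simp only [if_true, Bool.false_eq_true, if_false, Finset.prod_const, Finset.card_univ,
    Fintype.card_fin] at hlow
  have e1 : q / (1 - q) + 1 = (1 - q)⁻¹ := by field_simp; ring
  rw [e1] at hlow
  have e2 : ((1 - q)⁻¹ : ℝ) ^ n = (2 : ℝ) ^ (binEnt q * n) * (q / (1 - q)) ^ (q * n) := by
    rw [← Real.rpow_natCast, Real.rpow_def_of_pos (inv_pos.2 h1q), Real.rpow_def_of_pos two_pos,
      Real.rpow_def_of_pos hr0, ← Real.exp_add, Real.log_inv, Real.log_div hq0.ne' h1q.ne', binEnt,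
      Real.binEntropy]
    congr 1
    have : Real.log 2 ≠ 0 := (Real.log_pos one_lt_two).ne'
    rw [Real.log_inv, Real.log_inv]
    field_simp
    ring
  rw [e2] at hlow
  exact le_of_mul_le_mul_right hlow (Real.rpow_pos_of_pos hr0 _)

/-! ### The monogamy-of-entanglement game -/

section Monogamy

variable {D : Type*} [NormedAddCommGroup D] [InnerProductSpace ℂ D]

open ContinuousLinearMap in
lemma norm_adjoint_apply_le [CompleteSpace D] {S : D →L[ℂ] D} (h : ∀ v, ‖S v‖ ≤ ‖v‖) (v : D) :
    ‖adjoint S v‖ ≤ ‖v‖ := by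
  have h1 : ‖S‖ ≤ 1 := S.opNorm_le_bound zero_le_one (by simpa using h)
  have h2 : ‖adjoint S‖ ≤ 1 := by simpa using h1
  simpa using (adjoint S).le_of_opNorm_le h2 v

lemma norm_apply_le_of_sum_sq_le {X : Type*} [Fintype X] {S : X → D →L[ℂ] D}
    (h : ∀ v, ∑ x, ‖S x v‖ ^ 2 ≤ ‖v‖ ^ 2) (x : X) (v : D) : ‖S x v‖ ≤ ‖v‖ := by
  have h1 : ‖S x v‖ ^ 2 ≤ ∑ x, ‖S x v‖ ^ 2 :=
    Finset.single_le_sum (f := fun x => ‖S x v‖ ^ 2) (fun _ _ => by positivity)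
      (Finset.mem_univ x)
  exact le_of_sq_le_sq (h1.trans (h v)) (norm_nonneg _)

lemma sum_mul_le_sqrt_sum_mul_sqrt_sum {ι : Type*} (s : Finset ι) (f g : ι → ℝ) :
    ∑ i ∈ s, f i * g i ≤ √(∑ i ∈ s, f i ^ 2) * √(∑ i ∈ s, g i ^ 2) := by
  rw [← Real.sqrt_mul (Finset.sum_nonneg fun _ _ => sq_nonneg _)]
  exact Real.le_sqrt_of_sq_le (Finset.sum_mul_sq_le_sq_mul_sq s f g)

open ContinuousLinearMap in
/-- The overlap of the games for two bases. Moving `S' z` to the left and `R x` to the right leaves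
in each argument a family of measurement operators of one player, summed over the *other* index, so
only the maximal overlap `c` of the two bases survives the Cauchy–Schwarz inequality. -/
lemma sum_overlap_le [CompleteSpace D] {X Z : Type*} [Fintype X] [Fintype Z]
    (R S : X → D →L[ℂ] D) (R' S' : Z → D →L[ℂ] D)
    (hR : ∀ v, ∑ x, ‖R x v‖ ^ 2 ≤ ‖v‖ ^ 2) (hS : ∀ v, ∑ x, ‖S x v‖ ^ 2 ≤ ‖v‖ ^ 2)
    (hR' : ∀ v, ∑ z, ‖R' z v‖ ^ 2 ≤ ‖v‖ ^ 2) (hS' : ∀ v, ∑ z, ‖S' z v‖ ^ 2 ≤ ‖v‖ ^ 2)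
    (hRS : ∀ x, Commute (R x) (S x)) (hRS' : ∀ x z, Commute (adjoint (R x)) (S' z))
    (g : X → Z → ℂ) {c : ℝ} (hg : ∀ x z, ‖g x z‖ ≤ c) (hc : 0 ≤ c) (w : X → D) (w' : Z → D) :
    ‖∑ x, ∑ z, g x z * inner ℂ (adjoint (R x * S x) (w x)) (adjoint (R' z * S' z) (w' z))‖
      ≤ c * (√(∑ x, ‖w x‖ ^ 2) * √(∑ z, ‖w' z‖ ^ 2)) := by
  have hin : ∀ x z, inner ℂ (adjoint (R x * S x) (w x)) (adjoint (R' z * S' z) (w' z))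
      = inner ℂ (S' z (adjoint (S x) (w x))) (R x (adjoint (R' z) (w' z))) := by
    intro x z
    have e1 : adjoint (R x * S x) = adjoint (R x) * adjoint (S x) := by
      rw [(hRS x).eq]; exact adjoint_comp _ _
    have e2 : adjoint (R' z * S' z) = adjoint (S' z) * adjoint (R' z) := adjoint_comp _ _
    rw [e1, e2]
    change inner ℂ (adjoint (R x) (adjoint (S x) (w x)))
      (adjoint (S' z) (adjoint (R' z) (w' z))) = _
    rw [adjoint_inner_right]
    have e3 : S' z (adjoint (R x) (adjoint (S x) (w x)))
        = adjoint (R x) (S' z (adjoint (S x) (w x))) := by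
      have := (hRS' x z).eq
      exact (congrArg (fun T : D →L[ℂ] D => T (adjoint (S x) (w x))) this).symm
    rw [e3, adjoint_inner_left]
  have hSn : ∀ x v, ‖adjoint (S x) v‖ ≤ ‖v‖ := fun x =>
    norm_adjoint_apply_le (norm_apply_le_of_sum_sq_le hS x)
  have hRn : ∀ z v, ‖adjoint (R' z) v‖ ≤ ‖v‖ := fun z =>
    norm_adjoint_apply_le (norm_apply_le_of_sum_sq_le hR' z)
  have h1 : ∑ p : X × Z, ‖S' p.2 (adjoint (S p.1) (w p.1))‖ ^ 2 ≤ ∑ x, ‖w x‖ ^ 2 := by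
    rw [Fintype.sum_prod_type]
    refine Finset.sum_le_sum fun x _ => ?_
    exact (hS' (adjoint (S x) (w x))).trans (pow_le_pow_left₀ (norm_nonneg _) (hSn x (w x)) 2)
  have h2 : ∑ p : X × Z, ‖R p.1 (adjoint (R' p.2) (w' p.2))‖ ^ 2 ≤ ∑ z, ‖w' z‖ ^ 2 := by
    rw [Fintype.sum_prod_type_right]
    refine Finset.sum_le_sum fun z _ => ?_
    exact (hR (adjoint (R' z) (w' z))).trans (pow_le_pow_left₀ (norm_nonneg _) (hRn z (w' z)) 2)
  calc _ ≤ ∑ x, ∑ z, c * (‖S' z (adjoint (S x) (w x))‖ * ‖R x (adjoint (R' z) (w' z))‖) := by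
        refine (norm_sum_le _ _).trans (Finset.sum_le_sum fun x _ => ?_)
        refine (norm_sum_le _ _).trans (Finset.sum_le_sum fun z _ => ?_)
        rw [norm_mul, hin]
        exact mul_le_mul (hg x z) (norm_inner_le_norm _ _) (norm_nonneg _) hc
    _ = c * ∑ p : X × Z, ‖S' p.2 (adjoint (S p.1) (w p.1))‖ *
          ‖R p.1 (adjoint (R' p.2) (w' p.2))‖ := by
        rw [Fintype.sum_prod_type, Finset.mul_sum]
        simp only [Finset.mul_sum]
    _ ≤ c * (√(∑ p : X × Z, ‖S' p.2 (adjoint (S p.1) (w p.1))‖ ^ 2) *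
          √(∑ p : X × Z, ‖R p.1 (adjoint (R' p.2) (w' p.2))‖ ^ 2)) := by
        gcongr
        exact sum_mul_le_sqrt_sum_mul_sqrt_sum _ _ _
    _ ≤ _ := by gcongr

open ContinuousLinearMap in
/-- The monogamy game in the commuting-operator picture: `ψ` is the shared state, a vector in
`ℂ^I ⊗ D`; the referee measures the vectors `u θ x`, and `R θ x`, `S θ x` are the measurement
operators of the two players. If the overlaps of the bases `θ`, `θ'` are at most `c θ θ'`, the
probabilities that both players guess `x`, summed over `θ`, are bounded by the row sums of `c`
(the Schur test). -/
lemma sum_game_le [CompleteSpace D] {Θ X I : Type*} [Fintype Θ] [Fintype X] [Fintype I]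
    (u : Θ → X → I → ℂ) (R S : Θ → X → D →L[ℂ] D)
    (hR : ∀ θ v, ∑ x, ‖R θ x v‖ ^ 2 ≤ ‖v‖ ^ 2) (hS : ∀ θ v, ∑ x, ‖S θ x v‖ ^ 2 ≤ ‖v‖ ^ 2)
    (hRS : ∀ θ x, Commute (R θ x) (S θ x))
    (hRS' : ∀ θ x θ' z, Commute (adjoint (R θ x)) (S θ' z))
    (c : Θ → Θ → ℝ) (hc : ∀ θ θ', 0 ≤ c θ θ') (hcsymm : ∀ θ θ', c θ θ' = c θ' θ)
    (hu : ∀ θ θ' x z, ‖∑ a, star (u θ x a) * u θ' z a‖ ≤ c θ θ')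
    {C : ℝ} (hC0 : 0 ≤ C) (hC : ∀ θ, ∑ θ', c θ θ' ≤ C) (ψ : I → D) :
    ∑ θ, ∑ x, ‖R θ x (S θ x (∑ a, star (u θ x a) • ψ a))‖ ^ 2 ≤ C * ∑ a, ‖ψ a‖ ^ 2 := by
  set w : Θ → X → D := fun θ x => R θ x (S θ x (∑ a, star (u θ x a) • ψ a)) with hw
  set Φ : I → D := fun a => ∑ θ, ∑ x, u θ x a • adjoint (R θ x * S θ x) (w θ x) with hΦ
  set N : Θ → ℝ := fun θ => ∑ x, ‖w θ x‖ ^ 2 with hN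
  have hN0 : ∀ θ, 0 ≤ N θ := fun θ => Finset.sum_nonneg fun _ _ => by positivity
  change ∑ θ, N θ ≤ _
  set s := ∑ θ, N θ with hs
  have hs0 : 0 ≤ s := Finset.sum_nonneg fun θ _ => hN0 θ
  have hΨ0 : 0 ≤ ∑ a, ‖ψ a‖ ^ 2 := Finset.sum_nonneg fun _ _ => by positivity
  -- each `w θ x` is `R θ x * S θ x` applied to a component of `ψ`; moving the operator to the
  -- other side exhibits `s` as the inner product of `ψ` with a vector `Φ` linear in `w`
  have hself : (s : ℂ) = ∑ a, inner ℂ (Φ a) (ψ a) := by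
    have e1 : ∀ a, inner ℂ (Φ a) (ψ a)
        = ∑ θ, ∑ x, inner ℂ (adjoint (R θ x * S θ x) (w θ x)) (star (u θ x a) • ψ a) := by
      intro a
      simp only [hΦ, sum_inner, inner_smul_left, inner_smul_right]
      rfl
    have e2 : ∀ θ x, ∑ a, inner ℂ (adjoint (R θ x * S θ x) (w θ x)) (star (u θ x a) • ψ a)
        = ((‖w θ x‖ ^ 2 : ℝ) : ℂ) := by
      intro θ x
      rw [← inner_sum, adjoint_inner_left]
      change inner ℂ (w θ x) (w θ x) = _
      rw [inner_self_eq_norm_sq_to_K]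
      simp
    simp only [e1]
    rw [Finset.sum_comm, hs, Complex.ofReal_sum]
    refine Finset.sum_congr rfl fun θ _ => ?_
    rw [Finset.sum_comm]
    simp only [e2, hN, Complex.ofReal_sum]
  have hsΦ : s ≤ √(∑ a, ‖Φ a‖ ^ 2) * √(∑ a, ‖ψ a‖ ^ 2) := by
    calc s = ‖(s : ℂ)‖ := by simp [abs_of_nonneg hs0]
      _ ≤ ∑ a, ‖Φ a‖ * ‖ψ a‖ := by
        rw [hself]
        exact (norm_sum_le _ _).trans (Finset.sum_le_sum fun a _ => norm_inner_le_norm _ _)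
      _ ≤ _ := sum_mul_le_sqrt_sum_mul_sqrt_sum _ _ _
  have hΦs : ∑ a, ‖Φ a‖ ^ 2 ≤ C * s := by
    have e1 : ((∑ a, ‖Φ a‖ ^ 2 : ℝ) : ℂ) = ∑ θ, ∑ θ', ∑ x, ∑ z,
        (∑ a, star (u θ x a) * u θ' z a) *
          inner ℂ (adjoint (R θ x * S θ x) (w θ x)) (adjoint (R θ' z * S θ' z) (w θ' z)) := by
      have e3 : ∀ a, ((‖Φ a‖ ^ 2 : ℝ) : ℂ) = ∑ θ, ∑ θ', ∑ x, ∑ z,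
          (star (u θ x a) * u θ' z a) *
          inner ℂ (adjoint (R θ x * S θ x) (w θ x)) (adjoint (R θ' z * S θ' z) (w θ' z)) := by
        intro a
        have : ((‖Φ a‖ ^ 2 : ℝ) : ℂ) = inner ℂ (Φ a) (Φ a) := by
          rw [inner_self_eq_norm_sq_to_K]; simp
        rw [this]
        rw [sum_inner]
        refine Finset.sum_congr rfl fun θ _ => ?_
        rw [inner_sum]
        refine Finset.sum_congr rfl fun θ' _ => ?_
        rw [sum_inner]
        refine Finset.sum_congr rfl fun x _ => ?_
        rw [inner_sum]
        refine Finset.sum_congr rfl fun z _ => ?_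
        rw [inner_smul_left, inner_smul_right, ← mul_assoc]
        rfl
      rw [Complex.ofReal_sum]
      simp only [e3]
      rw [Finset.sum_comm]
      refine Finset.sum_congr rfl fun θ _ => ?_
      rw [Finset.sum_comm]
      refine Finset.sum_congr rfl fun θ' _ => ?_
      rw [Finset.sum_comm]
      refine Finset.sum_congr rfl fun x _ => ?_
      rw [Finset.sum_comm]
      refine Finset.sum_congr rfl fun z _ => ?_
      rw [Finset.sum_mul]
    have e2 : ∑ a, ‖Φ a‖ ^ 2 = ‖((∑ a, ‖Φ a‖ ^ 2 : ℝ) : ℂ)‖ := by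
      rw [Complex.norm_real, Real.norm_eq_abs,
        abs_of_nonneg (Finset.sum_nonneg fun _ _ => by positivity)]
    rw [e2, e1]
    calc _ ≤ ∑ θ, ∑ θ', c θ θ' * (√(N θ) * √(N θ')) := by
          refine (norm_sum_le _ _).trans (Finset.sum_le_sum fun θ _ => ?_)
          refine (norm_sum_le _ _).trans (Finset.sum_le_sum fun θ' _ => ?_)
          exact sum_overlap_le (R θ) (S θ) (R θ') (S θ') (hR θ) (hS θ) (hR θ') (hS θ')
            (hRS θ) (fun x z => hRS' θ x θ' z) _ (hu θ θ') (hc θ θ') (w θ) (w θ')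
      _ ≤ ∑ θ, ∑ θ', (c θ θ' * N θ / 2 + c θ θ' * N θ' / 2) := by
          refine Finset.sum_le_sum fun θ _ => Finset.sum_le_sum fun θ' _ => ?_
          have h := two_mul_le_add_sq (√(N θ)) (√(N θ'))
          rw [Real.sq_sqrt (hN0 _), Real.sq_sqrt (hN0 _)] at h
          have h' : √(N θ) * √(N θ') ≤ N θ / 2 + N θ' / 2 := by linarith
          calc _ ≤ c θ θ' * (N θ / 2 + N θ' / 2) := mul_le_mul_of_nonneg_left h' (hc θ θ')
            _ = _ := by ring
      _ = ∑ θ, (∑ θ', c θ θ') * N θ := by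
          have hsw : ∑ θ, ∑ θ', c θ θ' * N θ' / 2 = ∑ θ, ∑ θ', c θ θ' * N θ / 2 := by
            rw [Finset.sum_comm]
            simp only [hcsymm]
          simp only [Finset.sum_add_distrib]
          rw [hsw, ← Finset.sum_add_distrib]
          refine Finset.sum_congr rfl fun θ _ => ?_
          rw [← Finset.sum_add_distrib, Finset.sum_mul]
          exact Finset.sum_congr rfl fun _ _ => by ring
      _ ≤ ∑ θ, C * N θ := Finset.sum_le_sum fun θ _ => mul_le_mul_of_nonneg_right (hC θ) (hN0 θ)
      _ = C * s := by rw [Finset.mul_sum]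
  rcases hs0.eq_or_lt with h0 | h0
  · rw [← h0]
    positivity
  · have hsq : s ^ 2 ≤ (C * s) * ∑ a, ‖ψ a‖ ^ 2 := by
      calc s ^ 2 ≤ (√(∑ a, ‖Φ a‖ ^ 2) * √(∑ a, ‖ψ a‖ ^ 2)) ^ 2 :=
            pow_le_pow_left₀ hs0 hsΦ 2
        _ = (∑ a, ‖Φ a‖ ^ 2) * ∑ a, ‖ψ a‖ ^ 2 := by
            rw [mul_pow, Real.sq_sqrt (Finset.sum_nonneg fun _ _ => by positivity),
              Real.sq_sqrt hΨ0]
        _ ≤ _ := by gcongr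
    refine le_of_mul_le_mul_left ?_ h0
    calc s * s = s ^ 2 := by ring
      _ ≤ _ := hsq
      _ = _ := by ring

end Monogamy

/-! ### Privacy amplification against quantum side information -/

section HilbertSpaceHashing

variable {V : Type*} [NormedAddCommGroup V] [InnerProductSpace ℂ V]

/-- The collision estimate of universal hashing for vectors `v x` with non-negative correlations:
after hashing, the expected squared distance of the bucket sums from uniform is at most
`∑ x, ‖v x‖ ^ 2`. -/
lemma sum_norm_sq_bucket_sub_le {X ι K : Type*} [DecidableEq X] [Fintype ι] [Fintype K]
    [DecidableEq K] [Nonempty K] (s : Finset X) (v : X → V)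
    (hv : ∀ x ∈ s, ∀ x' ∈ s, 0 ≤ (inner ℂ (v x) (v x')).re) (F : ι → X → K)
    (hF : ∀ x ∈ s, ∀ x' ∈ s, x ≠ x' →
      ((Finset.univ.filter fun f => F f x = F f x').card : ℝ)
        ≤ Fintype.card ι / Fintype.card K) :
    ∑ f, ∑ k, ‖(∑ x ∈ s with F f x = k, v x) - (Fintype.card K : ℂ)⁻¹ • ∑ x ∈ s, v x‖ ^ 2
      ≤ Fintype.card ι * ∑ x ∈ s, ‖v x‖ ^ 2 := by
  set N : ℝ := ((Fintype.card K : ℕ) : ℝ) with hN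
  have hN0 : 0 < N := by rw [hN]; exact_mod_cast Fintype.card_pos
  set τ : V := ∑ x ∈ s, v x with hτ
  have hNc : (Fintype.card K : ℂ)⁻¹ = ((N⁻¹ : ℝ) : ℂ) := by rw [hN]; push_cast; rfl
  have hbucket : ∀ f, ∑ k, (∑ x ∈ s with F f x = k, v x) = τ := fun f =>
    Finset.sum_fiberwise s (F f) v
  have hvar : ∀ f, ∑ k, ‖(∑ x ∈ s with F f x = k, v x) - (Fintype.card K : ℂ)⁻¹ • τ‖ ^ 2
      = ∑ k, ‖∑ x ∈ s with F f x = k, v x‖ ^ 2 - N⁻¹ * ‖τ‖ ^ 2 := by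
    intro f
    have h1 : ∀ k, ‖(∑ x ∈ s with F f x = k, v x) - (Fintype.card K : ℂ)⁻¹ • τ‖ ^ 2
        = ‖∑ x ∈ s with F f x = k, v x‖ ^ 2
          - 2 * N⁻¹ * (inner ℂ (∑ x ∈ s with F f x = k, v x) τ).re + N⁻¹ ^ 2 * ‖τ‖ ^ 2 := by
      intro k
      rw [@norm_sub_sq ℂ, hNc, inner_smul_right, norm_smul, mul_pow, Complex.norm_real,
        Real.norm_eq_abs, sq_abs]
      simp only [RCLike.re_eq_complex_re, Complex.re_ofReal_mul]
      ring
    simp only [h1, Finset.sum_add_distrib, Finset.sum_sub_distrib, ← Finset.mul_sum]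
    rw [← Complex.re_sum, ← sum_inner, hbucket]
    have h2 : (inner ℂ τ τ).re = ‖τ‖ ^ 2 := inner_self_eq_norm_sq (𝕜 := ℂ) τ
    have h3 : N⁻¹ ^ 2 * ∑ _k : K, ‖τ‖ ^ 2 = N⁻¹ * ‖τ‖ ^ 2 := by
      rw [Finset.sum_const, Finset.card_univ, nsmul_eq_mul, ← hN]
      field_simp
    rw [h3, h2]
    ring
  have hcoll : ∀ f, ∑ k, ‖∑ x ∈ s with F f x = k, v x‖ ^ 2
      = ∑ x ∈ s, ∑ x' ∈ s, if F f x = F f x' then (inner ℂ (v x) (v x')).re else 0 := by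
    intro f
    have h1 : ∀ k, ‖∑ x ∈ s with F f x = k, v x‖ ^ 2
        = ∑ x ∈ s with F f x = k, ∑ x' ∈ s,
            if F f x = F f x' then (inner ℂ (v x) (v x')).re else 0 := by
      intro k
      have : ‖∑ x ∈ s with F f x = k, v x‖ ^ 2
          = (inner ℂ (∑ x ∈ s with F f x = k, v x) (∑ x ∈ s with F f x = k, v x)).re :=
        (inner_self_eq_norm_sq (𝕜 := ℂ) _).symm
      rw [this, sum_inner, Complex.re_sum]
      refine Finset.sum_congr rfl fun x hx => ?_
      rw [inner_sum, Complex.re_sum, Finset.sum_filter]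
      refine Finset.sum_congr rfl fun x' _ => ?_
      rw [← (Finset.mem_filter.1 hx).2]
      simp only [eq_comm]
    simp only [h1]
    exact Finset.sum_fiberwise s (F f) _
  have hτsq : ‖τ‖ ^ 2 = ∑ x ∈ s, ∑ x' ∈ s, (inner ℂ (v x) (v x')).re := by
    have : ‖τ‖ ^ 2 = (inner ℂ τ τ).re := (inner_self_eq_norm_sq (𝕜 := ℂ) _).symm
    rw [this, hτ]
    simp only [sum_inner, inner_sum, Complex.re_sum]
    exact Finset.sum_comm
  simp only [hvar, hcoll, Finset.sum_sub_distrib]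
  rw [Finset.sum_const, Finset.card_univ, nsmul_eq_mul, hτsq, sub_le_iff_le_add]
  calc ∑ f, ∑ x ∈ s, ∑ x' ∈ s, (if F f x = F f x' then (inner ℂ (v x) (v x')).re else 0)
      = ∑ x ∈ s, ∑ x' ∈ s, ((Finset.univ.filter fun f => F f x = F f x').card : ℝ)
          * (inner ℂ (v x) (v x')).re := by
        rw [Finset.sum_comm]
        refine Finset.sum_congr rfl fun x _ => ?_
        rw [Finset.sum_comm]
        refine Finset.sum_congr rfl fun x' _ => ?_
        rw [← Finset.sum_filter, Finset.sum_const, nsmul_eq_mul]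
    _ ≤ ∑ x ∈ s, ∑ x' ∈ s, ((if x = x' then Fintype.card ι * ‖v x‖ ^ 2 else 0)
          + Fintype.card ι * (N⁻¹ * (inner ℂ (v x) (v x')).re)) := by
        refine Finset.sum_le_sum fun x hx => Finset.sum_le_sum fun x' hx' => ?_
        have hnn := hv x hx x' hx'
        split_ifs with h
        · subst h
          have : (inner ℂ (v x) (v x)).re = ‖v x‖ ^ 2 := inner_self_eq_norm_sq (𝕜 := ℂ) _
          rw [this]
          simp only [Finset.filter_true, Finset.card_univ]
          have : 0 ≤ (Fintype.card ι : ℝ) * (N⁻¹ * ‖v x‖ ^ 2) := by positivity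
          linarith
        · rw [zero_add, ← mul_assoc, ← div_eq_mul_inv]
          exact mul_le_mul_of_nonneg_right (hF x hx x' hx' h) hnn
    _ = _ := by
        simp only [Finset.sum_add_distrib, Finset.mul_sum]
        congr 1
        refine Finset.sum_congr rfl fun x hx => ?_
        rw [Finset.sum_ite_eq]
        simp [hx]

end HilbertSpaceHashing

section Matrices

variable {H : Type*} [Fintype H]

open scoped MatrixOrder in
variable [DecidableEq H] in
lemma exists_eq_conjTranspose_mul_self {A : Matrix H H ℂ} (hA : A.PosSemidef) :
    ∃ B : Matrix H H ℂ, A = Bᴴ * B := by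
  obtain ⟨B, hB⟩ := CStarAlgebra.nonneg_iff_eq_star_mul_self.1
    (Matrix.nonneg_iff_posSemidef.2 hA)
  exact ⟨B, hB⟩

variable [DecidableEq H]

lemma trace_mul_nonneg {A B : Matrix H H ℂ} (hA : A.PosSemidef) (hB : B.PosSemidef) :
    0 ≤ (A * B).trace.re := by
  obtain ⟨C, rfl⟩ := exists_eq_conjTranspose_mul_self hB
  rw [← Matrix.mul_assoc, Matrix.trace_mul_comm, ← Matrix.mul_assoc]
  exact (Complex.nonneg_iff.1 (hA.mul_mul_conjTranspose_same C).trace_nonneg).1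

lemma trace_mul_le_trace {A B : Matrix H H ℂ} (hA : (1 - A).PosSemidef) (hB : B.PosSemidef) :
    (A * B).trace.re ≤ B.trace.re := by
  have h := trace_mul_nonneg hA hB
  rw [Matrix.sub_mul, Matrix.one_mul, Matrix.trace_sub, Complex.sub_re] at h
  linarith

lemma apply_eq_zero_of_posSemidef {A : Matrix H H ℂ} (hA : A.PosSemidef) {i : H} (h : A i i = 0)
    (j : H) : A i j = 0 ∧ A j i = 0 := by
  obtain ⟨B, rfl⟩ := exists_eq_conjTranspose_mul_self hA
  have hz : ∀ k, B k i = 0 := by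
    rw [Matrix.mul_apply] at h
    have h' : ∑ k, ((‖B k i‖ ^ 2 : ℝ) : ℂ) = 0 := by
      rw [← h]
      refine Finset.sum_congr rfl fun k _ => ?_
      rw [Matrix.conjTranspose_apply, Complex.ofReal_pow, ← Complex.conj_mul']
      rfl
    rw [← Complex.ofReal_sum, Complex.ofReal_eq_zero,
      Finset.sum_eq_zero_iff_of_nonneg fun _ _ => by positivity] at h'
    intro k
    simpa using h' k (Finset.mem_univ k)
  constructor <;> simp [Matrix.mul_apply, hz]

/-- `2 M - 1` is a contraction if `0 ≤ M ≤ 1`. -/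
lemma sum_norm_sq_two_smul_sub_one_le {M : Matrix H H ℂ} (hM : M.PosSemidef)
    (hM' : (1 - M).PosSemidef) (i : H) :
    ∑ j, ‖((2 : ℂ) • M - 1) i j‖ ^ 2 ≤ 1 := by
  have h1 : (M * (1 - M) * M + (1 - M) * M * (1 - M)).PosSemidef := by
    have a := hM'.mul_mul_conjTranspose_same M
    have b := hM.mul_mul_conjTranspose_same (1 - M)
    rw [hM.1] at a
    rw [hM'.1] at b
    exact a.add b
  have hC : ((2 : ℂ) • M - 1)ᴴ = (2 : ℂ) • M - 1 := by
    rw [Matrix.conjTranspose_sub, Matrix.conjTranspose_smul, hM.1, Matrix.conjTranspose_one]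
    simp
  have h2 : ((2 : ℂ) • M - 1) * ((2 : ℂ) • M - 1)ᴴ
      = 1 - (4 : ℂ) • (M * (1 - M) * M + (1 - M) * M * (1 - M)) := by
    rw [hC]
    have : (4 : ℂ) = 2 * 2 := by norm_num
    simp only [Matrix.mul_sub, Matrix.sub_mul, Matrix.mul_one, Matrix.one_mul, this, mul_smul,
      two_smul]
    noncomm_ring
  have h3 : ((∑ j, ‖((2 : ℂ) • M - 1) i j‖ ^ 2 : ℝ) : ℂ)
      = (((2 : ℂ) • M - 1) * ((2 : ℂ) • M - 1)ᴴ : Matrix H H ℂ) i i := by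
    rw [Matrix.mul_apply, Complex.ofReal_sum]
    refine Finset.sum_congr rfl fun j _ => ?_
    rw [Matrix.conjTranspose_apply, Complex.ofReal_pow, ← Complex.mul_conj']
    rfl
  rw [h2] at h3
  have h4 := (Complex.nonneg_iff.1 (h1.diag_nonneg (i := i))).1
  have h5 := congrArg Complex.re h3
  rw [Complex.ofReal_re, Matrix.sub_apply, Matrix.smul_apply, Matrix.one_apply_eq, Complex.sub_re,
    smul_eq_mul, Complex.one_re] at h5
  rw [h5]
  have h6 : ∀ z : ℂ, ((4 : ℂ) * z).re = 4 * z.re := fun z => by simp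
  rw [h6]
  linarith

omit [DecidableEq H] in
/-- A weighted Cauchy–Schwarz inequality for `tr (C A)`, with weights `√(lam i * lam j)`. -/
lemma sum_trace_mul_le {κ : Type*} [Fintype κ] {lam : H → ℝ} (hlam : ∀ i, 0 ≤ lam i)
    (C A : κ → Matrix H H ℂ) (hrow : ∀ k i, ∑ j, ‖C k i j‖ ^ 2 ≤ 1)
    (hcol : ∀ k j, ∑ i, ‖C k i j‖ ^ 2 ≤ 1)
    (hA : ∀ k i j, lam i * lam j = 0 → A k i j = 0) :
    ∑ k, (C k * A k).trace.re
      ≤ √(Fintype.card κ * ∑ i, lam i) *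
        √(∑ k, ∑ i, ∑ j, (√(lam i * lam j))⁻¹ * ‖A k i j‖ ^ 2) := by
  have h1 : ∑ k, (C k * A k).trace.re
      ≤ ∑ p : κ × H × H, (√(√(lam p.2.1 * lam p.2.2)) * ‖C p.1 p.2.1 p.2.2‖) *
          (√((√(lam p.2.1 * lam p.2.2))⁻¹) * ‖A p.1 p.2.2 p.2.1‖) := by
    simp only [Fintype.sum_prod_type]
    refine Finset.sum_le_sum fun k _ => ?_
    rw [Matrix.trace, Complex.re_sum]
    refine Finset.sum_le_sum fun i _ => ?_
    rw [Matrix.diag_apply, Matrix.mul_apply, Complex.re_sum]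
    refine Finset.sum_le_sum fun j _ => ?_
    refine (Complex.re_le_norm _).trans ?_
    rw [norm_mul]
    by_cases h0 : lam i * lam j = 0
    · rw [hA k j i (by rw [mul_comm]; exact h0)]
      simp
    · have hpos : 0 < lam i * lam j := lt_of_le_of_ne (mul_nonneg (hlam i) (hlam j)) (Ne.symm h0)
      have h2 : √(√(lam i * lam j)) * √((√(lam i * lam j))⁻¹) = 1 := by
        rw [← Real.sqrt_mul (Real.sqrt_nonneg _), mul_inv_cancel₀ (Real.sqrt_pos.2 hpos).ne',
          Real.sqrt_one]
      apply le_of_eq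
      linear_combination (-‖C k i j‖ * ‖A k j i‖) * h2
  refine h1.trans ((sum_mul_le_sqrt_sum_mul_sqrt_sum _ _ _).trans ?_)
  refine mul_le_mul (Real.sqrt_le_sqrt ?_) (Real.sqrt_le_sqrt ?_) (Real.sqrt_nonneg _)
    (Real.sqrt_nonneg _)
  · simp only [mul_pow, Real.sq_sqrt (Real.sqrt_nonneg _), Fintype.sum_prod_type]
    rw [← nsmul_eq_mul, ← Finset.card_univ, ← Finset.sum_const]
    refine Finset.sum_le_sum fun k _ => ?_
    calc ∑ i, ∑ j, √(lam i * lam j) * ‖C k i j‖ ^ 2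
        ≤ ∑ i, ∑ j, (lam i / 2 * ‖C k i j‖ ^ 2 + lam j / 2 * ‖C k i j‖ ^ 2) := by
          refine Finset.sum_le_sum fun i _ => Finset.sum_le_sum fun j _ => ?_
          rw [← add_mul]
          refine mul_le_mul_of_nonneg_right ?_ (by positivity)
          rw [Real.sqrt_mul (hlam i)]
          have h := two_mul_le_add_sq (√(lam i)) (√(lam j))
          rw [Real.sq_sqrt (hlam _), Real.sq_sqrt (hlam _)] at h
          linarith
      _ = ∑ i, lam i / 2 * ∑ j, ‖C k i j‖ ^ 2 + ∑ j, lam j / 2 * ∑ i, ‖C k i j‖ ^ 2 := by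
          simp only [Finset.sum_add_distrib, Finset.mul_sum]
          congr 1
          exact Finset.sum_comm
      _ ≤ ∑ i, lam i / 2 * 1 + ∑ j, lam j / 2 * 1 := by
          gcongr with i _ j _
          · linarith [hlam i]
          · exact hrow k i
          · linarith [hlam j]
          · exact hcol k j
      _ = ∑ i, lam i := by
          rw [← Finset.sum_add_distrib]
          exact Finset.sum_congr rfl fun _ _ => by ring
  · simp only [mul_pow, Fintype.sum_prod_type]
    refine Finset.sum_le_sum fun k _ => ?_
    rw [Finset.sum_comm]
    refine le_of_eq (Finset.sum_congr rfl fun i _ => Finset.sum_congr rfl fun j _ => ?_)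
    rw [Real.sq_sqrt (inv_nonneg.2 (Real.sqrt_nonneg _)), mul_comm (lam j)]

end Matrices

section PrettyGoodMeasurement

variable {H : Type*} [Fintype H] [DecidableEq H]

/-- The left-over hash lemma in an eigenbasis of the sum `diag(lam)` of the ensemble. `M` is the
pretty good measurement; the collision entropy in the usual proof is its guessing probability. At a
zero eigenvalue the junk value `0⁻¹ = 0` gives the pseudo-inverse. -/
lemma exists_subPOVM_sum_trace_le_of_diagonal {X ι K : Type*} [DecidableEq X] [Fintype ι]
    [Fintype K] [DecidableEq K] [Nonempty K] (s : Finset X) (ω : X → Matrix H H ℂ)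
    (hω : ∀ x, (ω x).PosSemidef) {lam : H → ℝ} (hlam : ∀ i, 0 ≤ lam i)
    (hτ : ∑ x ∈ s, ω x = Matrix.diagonal fun i => (lam i : ℂ)) (F : ι → X → K)
    (hF : ∀ x ∈ s, ∀ x' ∈ s, x ≠ x' →
      ((Finset.univ.filter fun f => F f x = F f x').card : ℝ)
        ≤ Fintype.card ι / Fintype.card K)
    (Q : ι → K → Matrix H H ℂ) (hQ0 : ∀ f k, (Q f k).PosSemidef)
    (hQ1 : ∀ f k, (1 - Q f k).PosSemidef) :
    ∃ M : X → Matrix H H ℂ, (∀ x, (M x).PosSemidef) ∧ (1 - ∑ x ∈ s, M x).PosSemidef ∧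
      ∑ f, ∑ k, (Q f k * ((∑ x ∈ s with F f x = k, ω x)
          - (Fintype.card K : ℂ)⁻¹ • ∑ x ∈ s, ω x)).trace.re
        ≤ Fintype.card ι / 2 * √(Fintype.card K * (∑ x ∈ s, ω x).trace.re *
            ∑ x ∈ s, (M x * ω x).trace.re) := by
  set N : Matrix H H ℂ := Matrix.diagonal fun i => (((√(lam i))⁻¹ : ℝ) : ℂ) with hN
  have hNH : Nᴴ = N := by
    rw [hN, Matrix.diagonal_conjTranspose]
    congr 1
    funext i
    simp
  set M : X → Matrix H H ℂ := fun x => N * ω x * N with hM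
  have hM0 : ∀ x, (M x).PosSemidef := fun x => by
    have := (hω x).mul_mul_conjTranspose_same N
    rwa [hNH] at this
  have hMapp : ∀ x i j, M x i j = (((√(lam i * lam j))⁻¹ : ℝ) : ℂ) * ω x i j := by
    intro x i j
    rw [hM]
    simp only [hN, Matrix.mul_diagonal, Matrix.diagonal_mul]
    rw [Real.sqrt_mul (hlam i), mul_inv]
    push_cast
    ring
  refine ⟨M, hM0, ?_, ?_⟩
  · have h1 : ∑ x ∈ s, M x = N * (∑ x ∈ s, ω x) * N := by
      rw [Finset.mul_sum, Finset.sum_mul]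
    rw [h1, hτ, hN, Matrix.diagonal_mul_diagonal, Matrix.diagonal_mul_diagonal,
      ← Matrix.diagonal_one, Matrix.diagonal_sub]
    refine Matrix.PosSemidef.diagonal fun i => ?_
    have h2 : (√(lam i))⁻¹ * lam i * (√(lam i))⁻¹ ≤ 1 := by
      by_cases h0 : lam i = 0
      · simp [h0]
      · have : √(lam i) ≠ 0 := by
          rw [Real.sqrt_ne_zero (hlam i)]; exact h0
        nth_rewrite 2 [← Real.mul_self_sqrt (hlam i)]
        apply le_of_eq
        field_simp
    have h3 : (0 : ℝ) ≤ 1 - (√(lam i))⁻¹ * lam i * (√(lam i))⁻¹ := by linarith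
    simpa using Complex.zero_le_real.2 h3
  -- the ensemble as vectors with the entries of `τ^(-1/4) ω τ^(-1/4)`
  set v : X → EuclideanSpace ℂ (H × H) := fun x =>
    WithLp.toLp 2 fun p => ((√((√(lam p.1 * lam p.2))⁻¹) : ℝ) : ℂ) * ω x p.1 p.2 with hv
  have hvin : ∀ x x', inner ℂ (v x) (v x') = (M x * ω x').trace := by
    intro x x'
    rw [PiLp.inner_apply, Fintype.sum_prod_type, Matrix.trace]
    simp only [Matrix.diag_apply, Matrix.mul_apply]
    rw [Finset.sum_comm]
    refine Finset.sum_congr rfl fun j _ => Finset.sum_congr rfl fun i _ => ?_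
    rw [hMapp]
    simp only [hv, RCLike.inner_apply, map_mul, Complex.conj_ofReal]
    have h1 : (starRingEnd ℂ) (ω x i j) = ω x j i := (hω x).1.apply j i
    have h2 : ((√((√(lam i * lam j))⁻¹) : ℝ) : ℂ) * ((√((√(lam i * lam j))⁻¹) : ℝ) : ℂ)
        = (((√(lam i * lam j))⁻¹ : ℝ) : ℂ) := by
      rw [← Complex.ofReal_mul, Real.mul_self_sqrt (inv_nonneg.2 (Real.sqrt_nonneg _))]
    rw [h1, mul_comm (lam j), ← h2]
    ring
  have hvnorm : ∀ x, ‖v x‖ ^ 2 = (M x * ω x).trace.re := by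
    intro x
    rw [← hvin]
    exact (inner_self_eq_norm_sq (𝕜 := ℂ) _).symm
  have hbucket := sum_norm_sq_bucket_sub_le s v
    (fun x _ x' _ => by rw [hvin]; exact trace_mul_nonneg (hM0 x) (hω x')) F hF
  simp only [hvnorm] at hbucket
  set A : ι → K → Matrix H H ℂ := fun f k =>
    (∑ x ∈ s with F f x = k, ω x) - (Fintype.card K : ℂ)⁻¹ • ∑ x ∈ s, ω x with hA
  have hAnorm : ∀ f k, ‖(∑ x ∈ s with F f x = k, v x) - (Fintype.card K : ℂ)⁻¹ • ∑ x ∈ s, v x‖ ^ 2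
      = ∑ i, ∑ j, (√(lam i * lam j))⁻¹ * ‖A f k i j‖ ^ 2 := by
    intro f k
    rw [EuclideanSpace.norm_sq_eq, Fintype.sum_prod_type]
    refine Finset.sum_congr rfl fun i _ => Finset.sum_congr rfl fun j _ => ?_
    have h1 : ((∑ x ∈ s with F f x = k, v x) - (Fintype.card K : ℂ)⁻¹ • ∑ x ∈ s, v x) (i, j)
        = ((√((√(lam i * lam j))⁻¹) : ℝ) : ℂ) * A f k i j := by
      simp only [hA, hv, PiLp.sub_apply, PiLp.smul_apply, WithLp.ofLp_sum, Finset.sum_apply,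
        Matrix.sub_apply, Matrix.smul_apply, Matrix.sum_apply, smul_eq_mul, mul_sub,
        Finset.mul_sum]
      congr 1
      exact Finset.sum_congr rfl fun _ _ => by ring
    rw [h1, norm_mul, mul_pow, Complex.norm_real, Real.norm_eq_abs, sq_abs,
      Real.sq_sqrt (inv_nonneg.2 (Real.sqrt_nonneg _))]
  simp only [hAnorm] at hbucket
  have hωzero : ∀ x ∈ s, ∀ i j, lam i * lam j = 0 → ω x i j = 0 := by
    intro x hx
    have hdiag : ∀ i, lam i = 0 → ω x i i = 0 := by
      intro i hi
      have h1 : ∑ x ∈ s, ω x i i = 0 := by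
        rw [← Matrix.sum_apply, hτ, Matrix.diagonal_apply_eq, hi, Complex.ofReal_zero]
      exact (Finset.sum_eq_zero_iff_of_nonneg fun y _ => (hω y).diag_nonneg).1 h1 x hx
    intro i j hij
    rcases mul_eq_zero.1 hij with h | h
    · exact (apply_eq_zero_of_posSemidef (hω x) (hdiag i h) j).1
    · exact (apply_eq_zero_of_posSemidef (hω x) (hdiag j h) i).2
  have hAzero : ∀ f k i j, lam i * lam j = 0 → A f k i j = 0 := by
    intro f k i j hij
    simp only [hA, Matrix.sub_apply, Matrix.smul_apply, Matrix.sum_apply]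
    rw [Finset.sum_eq_zero fun x hx => hωzero x (Finset.mem_filter.1 hx).1 i j hij,
      Finset.sum_eq_zero fun x hx => hωzero x hx i j hij]
    simp
  have hAsum : ∀ f, ∑ k, A f k = 0 := by
    intro f
    simp only [hA, Finset.sum_sub_distrib]
    rw [Finset.sum_fiberwise, Finset.sum_const, Finset.card_univ, ← Nat.cast_smul_eq_nsmul ℂ,
      smul_smul, mul_inv_cancel₀ (by exact_mod_cast Fintype.card_ne_zero), one_smul, sub_self]
  -- replacing the tests `Q` by `2 Q - 1` gains the factor `1 / 2`
  have hhalf : ∑ f, ∑ k, (Q f k * A f k).trace.re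
      = 1 / 2 * ∑ p : ι × K, (((2 : ℂ) • Q p.1 p.2 - 1) * A p.1 p.2).trace.re := by
    rw [Fintype.sum_prod_type, Finset.mul_sum]
    refine Finset.sum_congr rfl fun f _ => ?_
    have h1 : ∑ k, (A f k).trace.re = 0 := by
      rw [← Complex.re_sum, ← Matrix.trace_sum, hAsum, Matrix.trace_zero, Complex.zero_re]
    have h2 : ∀ k, (((2 : ℂ) • Q f k - 1) * A f k).trace.re
        = 2 * (Q f k * A f k).trace.re - (A f k).trace.re := by
      intro k
      rw [Matrix.sub_mul, Matrix.smul_mul, Matrix.trace_sub, Matrix.trace_smul, Matrix.one_mul]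
      simp
    simp only [h2, Finset.sum_sub_distrib, h1, ← Finset.mul_sum]
    ring
  change ∑ f, ∑ k, (Q f k * A f k).trace.re ≤ _
  rw [hhalf]
  have hherm : ∀ p : ι × K, ((2 : ℂ) • Q p.1 p.2 - 1)ᴴ = (2 : ℂ) • Q p.1 p.2 - 1 := by
    intro p
    rw [Matrix.conjTranspose_sub, Matrix.conjTranspose_smul, (hQ0 p.1 p.2).1,
      Matrix.conjTranspose_one]
    simp
  have hcs := sum_trace_mul_le hlam (fun p : ι × K => (2 : ℂ) • Q p.1 p.2 - 1)
    (fun p => A p.1 p.2)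
    (fun p i => sum_norm_sq_two_smul_sub_one_le (hQ0 p.1 p.2) (hQ1 p.1 p.2) i)
    (fun p j => by
      refine le_trans (le_of_eq ?_)
        (sum_norm_sq_two_smul_sub_one_le (hQ0 p.1 p.2) (hQ1 p.1 p.2) j)
      refine Finset.sum_congr rfl fun i _ => ?_
      conv_lhs => rw [← hherm p, Matrix.conjTranspose_apply, norm_star])
    (fun p => hAzero p.1 p.2)
  have htr : (∑ x ∈ s, ω x).trace.re = ∑ i, lam i := by
    rw [hτ, Matrix.trace_diagonal, Complex.re_sum]
    simp
  rw [htr]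
  have hlam0 : 0 ≤ ∑ i, lam i := Finset.sum_nonneg fun i _ => hlam i
  calc _ ≤ 1 / 2 * (√(Fintype.card (ι × K) * ∑ i, lam i) *
        √(Fintype.card ι * ∑ x ∈ s, (M x * ω x).trace.re)) := by
        refine mul_le_mul_of_nonneg_left (hcs.trans ?_) (by norm_num)
        gcongr
        rw [Fintype.sum_prod_type]
        exact hbucket
    _ = _ := by
        rw [← Real.sqrt_mul (by positivity), Fintype.card_prod]
        have : ((Fintype.card ι * Fintype.card K : ℕ) : ℝ) * (∑ i, lam i) *
            (Fintype.card ι * ∑ x ∈ s, (M x * ω x).trace.re)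
            = (Fintype.card ι : ℝ) ^ 2 * (Fintype.card K * (∑ i, lam i) *
              ∑ x ∈ s, (M x * ω x).trace.re) := by
          push_cast; ring
        rw [this, Real.sqrt_mul (by positivity), Real.sqrt_sq (by positivity)]
        ring

/-- The left-over hash lemma against quantum side information: an ensemble `ω` restricted to `s`,
hashed by a universal₂ family, is indistinguishable from uniform up to the square root of the
probability of guessing `x` by some measurement `M`. -/
lemma exists_subPOVM_sum_trace_le {X ι K : Type*} [DecidableEq X] [Fintype ι]
    [Fintype K] [DecidableEq K] [Nonempty K] (s : Finset X) (ω : X → Matrix H H ℂ)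
    (hω : ∀ x, (ω x).PosSemidef) (F : ι → X → K)
    (hF : ∀ x ∈ s, ∀ x' ∈ s, x ≠ x' →
      ((Finset.univ.filter fun f => F f x = F f x').card : ℝ)
        ≤ Fintype.card ι / Fintype.card K)
    (Q : ι → K → Matrix H H ℂ) (hQ0 : ∀ f k, (Q f k).PosSemidef)
    (hQ1 : ∀ f k, (1 - Q f k).PosSemidef) :
    ∃ M : X → Matrix H H ℂ, (∀ x, (M x).PosSemidef) ∧ (1 - ∑ x ∈ s, M x).PosSemidef ∧
      ∑ f, ∑ k, (Q f k * ((∑ x ∈ s with F f x = k, ω x)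
          - (Fintype.card K : ℂ)⁻¹ • ∑ x ∈ s, ω x)).trace.re
        ≤ Fintype.card ι / 2 * √(Fintype.card K * (∑ x ∈ s, ω x).trace.re *
            ∑ x ∈ s, (M x * ω x).trace.re) := by
  have hτ : (∑ x ∈ s, ω x).PosSemidef := Matrix.posSemidef_sum s fun x _ => hω x
  obtain ⟨U, lam, hU1, hU2, hlam, hdiag⟩ : ∃ (U : Matrix H H ℂ) (lam : H → ℝ), Uᴴ * U = 1 ∧
      U * Uᴴ = 1 ∧ (∀ i, 0 ≤ lam i) ∧
      Uᴴ * (∑ x ∈ s, ω x) * U = Matrix.diagonal fun i => (lam i : ℂ) := by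
    have hUm := hτ.1.eigenvectorUnitary.2
    have hU1 := (Unitary.mem_iff.1 hUm).1
    have hU2 := (Unitary.mem_iff.1 hUm).2
    refine ⟨hτ.1.eigenvectorUnitary, hτ.1.eigenvalues, hU1, hU2, hτ.eigenvalues_nonneg, ?_⟩
    have := hτ.1.conjStarAlgAut_star_eigenvectorUnitary
    rw [Unitary.conjStarAlgAut_star_apply] at this
    exact this
  have hconj : ∀ A B : Matrix H H ℂ, (Uᴴ * A * U) * (Uᴴ * B * U) = Uᴴ * (A * B) * U := by
    intro A B
    calc (Uᴴ * A * U) * (Uᴴ * B * U) = Uᴴ * A * (U * Uᴴ) * B * U := by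
          simp only [Matrix.mul_assoc]
      _ = _ := by rw [hU2]; simp only [Matrix.mul_assoc, Matrix.mul_one]
  have htr : ∀ A : Matrix H H ℂ, (Uᴴ * A * U).trace = A.trace := by
    intro A
    rw [Matrix.trace_mul_comm, ← Matrix.mul_assoc, hU2, Matrix.one_mul]
  have hconj1 : ∀ A : Matrix H H ℂ, 1 - Uᴴ * A * U = Uᴴ * (1 - A) * U := by
    intro A
    rw [Matrix.mul_sub, Matrix.sub_mul, Matrix.mul_one, hU1]
  have hsum : ∀ s' : Finset X, ∑ x ∈ s', Uᴴ * ω x * U = Uᴴ * (∑ x ∈ s', ω x) * U := by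
    intro s'
    rw [Finset.mul_sum, Finset.sum_mul]
  obtain ⟨M, hM0, hM1, hM⟩ := exists_subPOVM_sum_trace_le_of_diagonal s
    (fun x => Uᴴ * ω x * U) (fun x => (hω x).conjTranspose_mul_mul_same U) hlam
    ((hsum s).trans hdiag) F hF (fun f k => Uᴴ * Q f k * U)
    (fun f k => (hQ0 f k).conjTranspose_mul_mul_same U)
    (fun f k => by
      rw [hconj1]
      exact (hQ1 f k).conjTranspose_mul_mul_same U)
  refine ⟨fun x => U * M x * Uᴴ, fun x => (hM0 x).mul_mul_conjTranspose_same U, ?_, ?_⟩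
  · have h1 : 1 - ∑ x ∈ s, U * M x * Uᴴ = U * (1 - ∑ x ∈ s, M x) * Uᴴ := by
      rw [Matrix.mul_sub, Matrix.sub_mul, Matrix.mul_one, hU2, Finset.mul_sum, Finset.sum_mul]
    rw [h1]
    exact hM1.mul_mul_conjTranspose_same U
  · have h2 : ∀ x, (M x * (Uᴴ * ω x * U)).trace = (U * M x * Uᴴ * ω x).trace := by
      intro x
      rw [← Matrix.mul_assoc, Matrix.trace_mul_comm]
      simp only [Matrix.mul_assoc]
    have h3 : ∀ f k, (Uᴴ * Q f k * U * ((∑ x ∈ s with F f x = k, Uᴴ * ω x * U)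
          - (Fintype.card K : ℂ)⁻¹ • ∑ x ∈ s, Uᴴ * ω x * U)).trace
        = (Q f k * ((∑ x ∈ s with F f x = k, ω x)
          - (Fintype.card K : ℂ)⁻¹ • ∑ x ∈ s, ω x)).trace := by
      intro f k
      rw [hsum, hsum, ← Matrix.smul_mul, ← Matrix.mul_smul, ← Matrix.sub_mul, ← Matrix.mul_sub,
        hconj, htr]
    simp only [h2, h3] at hM
    simp only [hsum, htr] at hM
    exact hM

end PrettyGoodMeasurement

/-! ### BB84 bases -/

/-- The basis change of a single qubit: the Hadamard matrix or the identity. -/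
def basisGate (b : Bool) : Matrix Bool Bool ℂ := if b then hadamardGate else 1

lemma sqrt_two_inv_mul_self :
    ((Real.sqrt 2 : ℝ) : ℂ)⁻¹ * ((Real.sqrt 2 : ℝ) : ℂ)⁻¹ = 1 / 2 := by
  rw [← mul_inv, ← Complex.ofReal_mul, Real.mul_self_sqrt (by norm_num)]
  norm_num

lemma bb84Vec_eq {n : ℕ} (θ x z : Bits n) : bb84Vec θ x z = ∏ i, basisGate (θ i) (z i) (x i) := rfl

lemma sum_star_bb84Vec_mul_bb84Vec {n : ℕ} (θ a a' : Bits n) :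
    ∑ x, star (bb84Vec θ x a) * bb84Vec θ x a' = if a = a' then 1 else 0 := by
  simp only [bb84Vec_eq, star_prod, ← Finset.prod_mul_distrib]
  rw [sum_bits_prod_eq_prod_sum
    (fun i b => star (basisGate (θ i) (a i) b) * basisGate (θ i) (a' i) b)]
  have h : ∀ b c c', star (basisGate b c true) * basisGate b c' true
      + star (basisGate b c false) * basisGate b c' false = if c = c' then 1 else 0 := by
    have h2 := sqrt_two_inv_mul_self
    intro b c c'
    cases b <;> cases c <;> cases c' <;>
      simp [basisGate, hadamardGate, Complex.conj_ofReal, h2] <;> norm_num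
  simp only [h, Finset.prod_ite_zero]
  simp [funext_iff]

/-- The bound on the overlap of the BB84 bases `θ` and `θ'`: a factor `1/√2` for every position at
which they differ. -/
def overlapBound {n : ℕ} (θ θ' : Bits n) : ℝ := ∏ i, if θ i = θ' i then 1 else (√2)⁻¹

lemma norm_sum_star_bb84Vec_mul_bb84Vec_le {n : ℕ} (θ θ' x z : Bits n) :
    ‖∑ a, star (bb84Vec θ x a) * bb84Vec θ' z a‖ ≤ overlapBound θ θ' := by
  simp only [bb84Vec_eq, star_prod, ← Finset.prod_mul_distrib]
  rw [sum_bits_prod_eq_prod_sum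
    (fun i b => star (basisGate (θ i) b (x i)) * basisGate (θ' i) b (z i)), norm_prod]
  refine Finset.prod_le_prod (fun _ _ => norm_nonneg _) fun i _ => ?_
  have h2 := sqrt_two_inv_mul_self
  have h3 : |√(2 : ℝ)| = √2 := abs_of_nonneg (Real.sqrt_nonneg _)
  generalize θ i = b, θ' i = b', x i = c, z i = c'
  cases b <;> cases b' <;> cases c <;> cases c' <;>
    simp [basisGate, hadamardGate, Complex.conj_ofReal, h2, h3] <;> norm_num

lemma sum_overlapBound {n : ℕ} (θ : Bits n) : ∑ θ', overlapBound θ θ' = (2 * betaZero) ^ n := by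
  unfold overlapBound
  rw [sum_bits_prod_eq_prod_sum (fun i b => if θ i = b then (1 : ℝ) else (√2)⁻¹)]
  have h : ∀ b : Bool, ((if b = true then (1 : ℝ) else (√2)⁻¹) + if b = false then 1 else (√2)⁻¹)
      = 2 * betaZero := by
    intro b
    have : √(2 : ℝ) ≠ 0 := by positivity
    cases b <;> simp [betaZero] <;> field_simp
    all_goals ring
  simp only [h]
  simp

/-! ### Eve's conditional states -/

section EveState

lemma sum_comm_reverse₃ {α β γ M : Type*} [Fintype α] [Fintype β] [Fintype γ] [AddCommMonoid M]
    (f : α → β → γ → M) : ∑ a, ∑ b, ∑ c, f a b c = ∑ c, ∑ b, ∑ a, f a b c := by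
  rw [Finset.sum_comm]
  simp only [Finset.sum_comm (s := (Finset.univ : Finset α))]
  exact Finset.sum_comm

lemma sum_comm_reverse₄ {α β γ δ M : Type*} [Fintype α] [Fintype β] [Fintype γ] [Fintype δ]
    [AddCommMonoid M] (f : α → β → γ → δ → M) :
    ∑ a, ∑ b, ∑ c, ∑ d, f a b c d = ∑ d, ∑ c, ∑ b, ∑ a, f a b c d := by
  rw [sum_comm_reverse₃]
  have h : ∀ c b, ∑ a, ∑ d, f a b c d = ∑ d, ∑ a, f a b c d := fun c b => Finset.sum_comm
  simp only [h]
  rw [sum_comm_reverse₃]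
  exact Finset.sum_congr rfl fun d _ => Finset.sum_comm

variable {n : ℕ} {B E : Type} [Fintype B] [Fintype E]

/-- The (unnormalized) pure states in the ensemble of `Attack.state`, as families of vectors of the
device and Eve that are indexed by Alice's computational basis. -/
def Attack.vec (A : Attack n B E) (j : Fin A.rank) (a : Bits n) (d : B × E) : ℂ :=
  (((1 : Matrix (Bits n) (Bits n) ℂ) ⊗ₖ A.kraus j) *ᵥ eprVec n) (a, d)

/-- The pure states of the device and Eve after Alice has found `x` in basis `θ`. -/
def Attack.postVec (A : Attack n B E) (θ x : Bits n) (j : Fin A.rank) (d : B × E) : ℂ :=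
  ∑ a, star (bb84Vec θ x a) * A.vec j a d

lemma Attack.state_apply (A : Attack n B E) (a a' : Bits n) (d d' : B × E) :
    A.state (a, d) (a', d') = ∑ j, A.vec j a d * star (A.vec j a' d') := by
  rw [Attack.state, Matrix.sum_apply]
  refine Finset.sum_congr rfl fun j _ => ?_
  rw [eprState, Matrix.mul_vecMulVec, Matrix.vecMulVec_mul, Matrix.vecMulVec_apply,
    Attack.vec, Attack.vec]
  congr 1
  rw [Matrix.vecMul_conjTranspose, star_star]
  rfl

lemma Attack.vec_eq (A : Attack n B E) (j : Fin A.rank) (a : Bits n) (d : B × E) :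
    A.vec j a d = ((Real.sqrt 2 : ℝ) : ℂ)⁻¹ ^ n * A.kraus j d a := by
  have hepr : ∀ p : Bits n × Bits n, eprVec n p
      = if p.1 = p.2 then ((Real.sqrt 2 : ℝ) : ℂ)⁻¹ ^ n else 0 := by
    intro p
    rw [eprVec, Finset.prod_ite_zero]
    simp [funext_iff]
  rw [Attack.vec, Matrix.mulVec, dotProduct, Fintype.sum_prod_type]
  simp only [Matrix.kroneckerMap_apply, hepr, Matrix.one_apply]
  simp [mul_comm]

lemma Attack.sum_norm_sq_vec (A : Attack n B E) : ∑ j, ∑ a, ∑ d, ‖A.vec j a d‖ ^ 2 = 1 := by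
  have h1 : ∀ j a d, ‖A.vec j a d‖ ^ 2 = (1 / 2) ^ n * ‖A.kraus j d a‖ ^ 2 := by
    intro j a d
    rw [Attack.vec_eq, norm_mul, mul_pow, norm_pow, norm_inv, Complex.norm_real, Real.norm_eq_abs,
      abs_of_nonneg (Real.sqrt_nonneg _), ← pow_mul, mul_comm n 2, pow_mul, inv_pow,
      Real.sq_sqrt (by norm_num)]
    norm_num
  have h2 : ∀ a, ∑ j, ∑ d, ‖A.kraus j d a‖ ^ 2 = 1 := by
    intro a
    have h := congrArg (fun M : Matrix (Bits n) (Bits n) ℂ => M a a) A.trace_preserving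
    simp only [Matrix.sum_apply, Matrix.mul_apply, Matrix.conjTranspose_apply,
      Matrix.one_apply_eq] at h
    have h3 : ((∑ j, ∑ d, ‖A.kraus j d a‖ ^ 2 : ℝ) : ℂ) = 1 := by
      rw [← h]
      push_cast
      refine Finset.sum_congr rfl fun j _ => Finset.sum_congr rfl fun d _ => ?_
      rw [← Complex.conj_mul']
      rfl
    exact_mod_cast h3
  simp only [h1, ← Finset.mul_sum]
  rw [Finset.sum_comm]
  simp only [h2]
  simp

lemma Attack.sum_norm_sq_postVec (A : Attack n B E) (θ : Bits n) :
    ∑ x, ∑ j, ∑ d, ‖A.postVec θ x j d‖ ^ 2 = 1 := by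
  rw [← A.sum_norm_sq_vec, Finset.sum_comm]
  refine Finset.sum_congr rfl fun j _ => ?_
  rw [Finset.sum_comm, Finset.sum_comm (f := fun a d => ‖A.vec j a d‖ ^ 2)]
  refine Finset.sum_congr rfl fun d _ => ?_
  have h : ((∑ x, ‖A.postVec θ x j d‖ ^ 2 : ℝ) : ℂ) = ((∑ a, ‖A.vec j a d‖ ^ 2 : ℝ) : ℂ) := by
    push_cast
    have h1 : ∀ x, (‖A.postVec θ x j d‖ : ℂ) ^ 2 = ∑ a, ∑ a',
        (star (bb84Vec θ x a) * bb84Vec θ x a') * (A.vec j a d * star (A.vec j a' d)) := by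
      intro x
      rw [← Complex.mul_conj', Attack.postVec, map_sum, Finset.sum_mul_sum]
      refine Finset.sum_congr rfl fun a _ => Finset.sum_congr rfl fun a' _ => ?_
      rw [map_mul]
      simp only [starRingEnd_apply, star_star]
      ring
    simp only [h1]
    rw [Finset.sum_comm]
    refine Finset.sum_congr rfl fun a _ => ?_
    rw [Finset.sum_comm]
    simp only [← Finset.sum_mul, sum_star_bb84Vec_mul_bb84Vec, ite_mul, one_mul, zero_mul,
      Finset.sum_ite_eq, Finset.mem_univ, if_true]
    exact Complex.mul_conj' _
  exact_mod_cast h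

variable [DecidableEq B] [DecidableEq E]

lemma eveState_apply (A : Attack n B E) (P : Bits n → POVM (Bits n) B) (θ x y : Bits n)
    (e e' : E) : eveState A P θ x y e e' = ∑ b, ∑ b', (P θ).op y b b' *
      ∑ j, A.postVec θ x j (b', e) * star (A.postVec θ x j (b, e')) := by
  rw [eveState, traceFst, Matrix.of_apply]
  refine Finset.sum_congr rfl fun b _ => ?_
  rw [traceFst, Matrix.of_apply]
  have h1 : ∀ a, ((bb84Proj θ x ⊗ₖ ((P θ).op y ⊗ₖ (1 : Matrix E E ℂ))) * A.state)
        (a, (b, e)) (a, (b, e'))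
      = ∑ b', ∑ a', ∑ j, (P θ).op y b b' * ((star (bb84Vec θ x a') * A.vec j a' (b', e)) *
          star (star (bb84Vec θ x a) * A.vec j a (b, e'))) := by
    intro a
    simp only [Matrix.mul_apply, Fintype.sum_prod_type, Matrix.kroneckerMap_apply,
      Attack.state_apply, bb84Proj, Matrix.vecMulVec_apply, Matrix.one_apply, Pi.star_apply]
    simp only [mul_ite, mul_one, mul_zero, ite_mul, zero_mul, Finset.sum_ite_eq, Finset.mem_univ,
      if_true]
    rw [Finset.sum_comm]
    refine Finset.sum_congr rfl fun b' _ => Finset.sum_congr rfl fun a' _ => ?_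
    rw [Finset.mul_sum]
    refine Finset.sum_congr rfl fun j _ => ?_
    rw [star_mul', star_star]
    ring
  simp only [h1]
  rw [Finset.sum_comm]
  refine Finset.sum_congr rfl fun b' _ => ?_
  rw [sum_comm_reverse₃, Finset.mul_sum]
  refine Finset.sum_congr rfl fun j _ => ?_
  simp only [Attack.postVec, star_sum]
  rw [Finset.sum_mul_sum]
  simp only [Finset.mul_sum]

/-- If Bob's device uses the measurement operator `Rᴴ * R`, Eve's states form the ensemble of the
partial vectors of `R` applied to the post-measurement states. -/
lemma eveState_eq_sum (A : Attack n B E) (P : Bits n → POVM (Bits n) B) (θ x y : Bits n)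
    {R : Matrix B B ℂ} (hR : (P θ).op y = Rᴴ * R) :
    eveState A P θ x y = ∑ j, ∑ c, Matrix.vecMulVec (fun e => ∑ b, R c b * A.postVec θ x j (b, e))
      (star fun e => ∑ b, R c b * A.postVec θ x j (b, e)) := by
  ext e e'
  have h1 : ∀ b b', (P θ).op y b b' *
        ∑ j, A.postVec θ x j (b', e) * star (A.postVec θ x j (b, e'))
      = ∑ c, ∑ j, R c b' * A.postVec θ x j (b', e) * star (R c b * A.postVec θ x j (b, e')) := by
    intro b b'
    rw [hR, Matrix.mul_apply, Finset.sum_mul_sum]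
    refine Finset.sum_congr rfl fun c _ => Finset.sum_congr rfl fun j _ => ?_
    rw [star_mul', Matrix.conjTranspose_apply]
    ring
  rw [eveState_apply]
  simp only [h1]
  rw [sum_comm_reverse₄, Matrix.sum_apply]
  refine Finset.sum_congr rfl fun j _ => ?_
  rw [Matrix.sum_apply]
  refine Finset.sum_congr rfl fun c _ => ?_
  rw [Matrix.vecMulVec_apply, Pi.star_apply, star_sum, Finset.sum_mul_sum]

lemma eveState_posSemidef (A : Attack n B E) (P : Bits n → POVM (Bits n) B) (θ x y : Bits n) :
    (eveState A P θ x y).PosSemidef := by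
  obtain ⟨R, hR⟩ := exists_eq_conjTranspose_mul_self ((P θ).posSemidef y)
  rw [eveState_eq_sum A P θ x y hR]
  exact Matrix.posSemidef_sum _ fun j _ => Matrix.posSemidef_sum _ fun c _ =>
    Matrix.posSemidef_vecMulVec_self_star _

lemma norm_sq_toEuclideanCLM {D : Type*} [Fintype D] [DecidableEq D] (T : Matrix D D ℂ)
    (v : D → ℂ) : ‖Matrix.toEuclideanCLM (n := D) (𝕜 := ℂ) T (WithLp.toLp 2 v)‖ ^ 2
      = ∑ d, ‖∑ d', T d d' * v d'‖ ^ 2 := by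
  rw [Matrix.toEuclideanCLM_toLp, EuclideanSpace.norm_sq_eq]
  rfl

lemma trace_mul_eveState (A : Attack n B E) (P : Bits n → POVM (Bits n) B) (θ x y : Bits n)
    {R : Matrix B B ℂ} (hR : (P θ).op y = Rᴴ * R) (S : Matrix E E ℂ) :
    (Sᴴ * S * eveState A P θ x y).trace.re
      = ∑ j, ‖Matrix.toEuclideanCLM (n := B × E) (𝕜 := ℂ) (R ⊗ₖ (1 : Matrix E E ℂ))
          (Matrix.toEuclideanCLM (n := B × E) (𝕜 := ℂ) ((1 : Matrix B B ℂ) ⊗ₖ S)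
            (WithLp.toLp 2 (A.postVec θ x j)))‖ ^ 2 := by
  have h1 : ∀ j, Matrix.toEuclideanCLM (n := B × E) (𝕜 := ℂ) (R ⊗ₖ (1 : Matrix E E ℂ))
          (Matrix.toEuclideanCLM (n := B × E) (𝕜 := ℂ) ((1 : Matrix B B ℂ) ⊗ₖ S)
            (WithLp.toLp 2 (A.postVec θ x j)))
      = Matrix.toEuclideanCLM (n := B × E) (𝕜 := ℂ) (R ⊗ₖ S)
            (WithLp.toLp 2 (A.postVec θ x j)) := by
    intro j
    have : R ⊗ₖ S = (R ⊗ₖ (1 : Matrix E E ℂ)) * ((1 : Matrix B B ℂ) ⊗ₖ S) := by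
      rw [← Matrix.mul_kronecker_mul, Matrix.mul_one, Matrix.one_mul]
    rw [this, map_mul]
    rfl
  simp only [h1, norm_sq_toEuclideanCLM]
  rw [eveState_eq_sum A P θ x y hR, Finset.mul_sum, Matrix.trace_sum, Complex.re_sum]
  refine Finset.sum_congr rfl fun j _ => ?_
  rw [Finset.mul_sum, Matrix.trace_sum, Complex.re_sum, Fintype.sum_prod_type]
  refine Finset.sum_congr rfl fun c _ => ?_
  rw [Matrix.mul_assoc, Matrix.trace_mul_comm, Matrix.mul_vecMulVec, Matrix.vecMulVec_mul,
    ← Matrix.star_mulVec, Matrix.trace_vecMulVec, dotProduct, Complex.re_sum]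
  refine Finset.sum_congr rfl fun e _ => ?_
  have h2 : ∑ d', (R ⊗ₖ S) (c, e) d' * A.postVec θ x j d'
      = (S *ᵥ fun e => ∑ b, R c b * A.postVec θ x j (b, e)) e := by
    rw [Matrix.mulVec, dotProduct, Fintype.sum_prod_type, Finset.sum_comm]
    refine Finset.sum_congr rfl fun e' _ => ?_
    rw [Finset.mul_sum]
    refine Finset.sum_congr rfl fun b _ => ?_
    rw [Matrix.kroneckerMap_apply]
    ring
  rw [h2, Pi.star_apply]
  exact (congrArg Complex.re (Complex.mul_conj' _)).trans
    (by rw [← Complex.ofReal_pow, Complex.ofReal_re])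

lemma sum_trace_eveState (A : Attack n B E) (P : Bits n → POVM (Bits n) B) (θ : Bits n) :
    ∑ x, ∑ y, (eveState A P θ x y).trace.re = 1 := by
  rw [← A.sum_norm_sq_postVec θ]
  refine Finset.sum_congr rfl fun x _ => ?_
  have h1 : ∑ y, (eveState A P θ x y).trace
      = ∑ e, ∑ b, ∑ j, A.postVec θ x j (b, e) * star (A.postVec θ x j (b, e)) := by
    simp only [Matrix.trace, Matrix.diag_apply, eveState_apply]
    rw [Finset.sum_comm]
    refine Finset.sum_congr rfl fun e _ => ?_
    rw [Finset.sum_comm]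
    refine Finset.sum_congr rfl fun b _ => ?_
    rw [Finset.sum_comm]
    have h2 : ∀ b', ∑ y, (P θ).op y b b' = if b = b' then 1 else 0 := by
      intro b'
      rw [← Matrix.sum_apply, (P θ).sum_eq_one, Matrix.one_apply]
    simp only [← Finset.sum_mul, h2, ite_mul, one_mul, zero_mul, Finset.sum_ite_eq,
      Finset.mem_univ, if_true]
  rw [← Complex.re_sum, h1, sum_comm_reverse₃, Complex.re_sum]
  refine Finset.sum_congr rfl fun j _ => ?_
  rw [Fintype.sum_prod_type, Complex.re_sum]
  refine Finset.sum_congr rfl fun b _ => ?_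
  rw [Complex.re_sum]
  refine Finset.sum_congr rfl fun e _ => ?_
  exact (congrArg Complex.re (Complex.mul_conj' _)).trans
    (by rw [← Complex.ofReal_pow, Complex.ofReal_re])

end EveState

/-! ### Guessing Alice's string -/

section Guessing

lemma sum_norm_sq_toEuclideanCLM_le {X D : Type*} [Fintype X] [Fintype D] [DecidableEq D]
    (T : X → Matrix D D ℂ) (hT : (1 - ∑ x, (T x)ᴴ * T x).PosSemidef) (v : EuclideanSpace ℂ D) :
    ∑ x, ‖Matrix.toEuclideanCLM (n := D) (𝕜 := ℂ) (T x) v‖ ^ 2 ≤ ‖v‖ ^ 2 := by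
  have h1 : ∀ T : Matrix D D ℂ, star v.ofLp ⬝ᵥ ((Tᴴ * T) *ᵥ v.ofLp)
      = ((‖Matrix.toEuclideanCLM (n := D) (𝕜 := ℂ) T v‖ ^ 2 : ℝ) : ℂ) := by
    intro T
    rw [← Matrix.mulVec_mulVec, Matrix.dotProduct_mulVec, Matrix.vecMul_conjTranspose, star_star]
    have h2 := norm_sq_toEuclideanCLM T v.ofLp
    rw [WithLp.toLp_ofLp] at h2
    rw [h2, dotProduct, Complex.ofReal_sum]
    refine Finset.sum_congr rfl fun d _ => ?_
    rw [Complex.ofReal_pow, ← Complex.conj_mul']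
    rfl
  have h3 := (Complex.nonneg_iff.1 (hT.dotProduct_mulVec_nonneg v.ofLp)).1
  have h4 : star v.ofLp ⬝ᵥ ((1 : Matrix D D ℂ) *ᵥ v.ofLp) = ((‖v‖ ^ 2 : ℝ) : ℂ) := by
    have := h1 1
    rw [Matrix.conjTranspose_one, Matrix.one_mul, map_one] at this
    exact this
  rw [Matrix.sub_mulVec, dotProduct_sub, h4, Matrix.sum_mulVec, dotProduct_sum] at h3
  simp only [h1, ← Complex.ofReal_sum, ← Complex.ofReal_sub, Complex.ofReal_re] at h3
  linarith

variable {n : ℕ} {B E : Type} [Fintype B] [Fintype E] [DecidableEq B] [DecidableEq E]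

/-- The monogamy game of the protocol: for any relabelling `σ` of the outcomes of Bob's device,
his device and Eve (with any measurements `M θ`) cannot both guess Alice's string too well. -/
lemma sum_trace_mul_eveState_perm_le (A : Attack n B E) (P : Bits n → POVM (Bits n) B)
    (σ : Equiv.Perm (Bits n)) (M : Bits n → Bits n → Matrix E E ℂ)
    (hM0 : ∀ θ x, (M θ x).PosSemidef) (hM1 : ∀ θ, (1 - ∑ x, M θ x).PosSemidef) :
    ∑ θ, ∑ x, (M θ x * eveState A P θ x (σ x)).trace.re ≤ (2 * betaZero) ^ n := by
  -- any factorizations `Rᴴ * R` and `Sᴴ * S` of the measurement operators will do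
  choose R hR using fun θ x => exists_eq_conjTranspose_mul_self
    ((P θ).posSemidef (σ x))
  choose S hS using fun θ x => exists_eq_conjTranspose_mul_self (hM0 θ x)
  set R' : Bits n → Bits n → EuclideanSpace ℂ (B × E) →L[ℂ] EuclideanSpace ℂ (B × E) :=
    fun θ x => Matrix.toEuclideanCLM (n := B × E) (𝕜 := ℂ) (R θ x ⊗ₖ (1 : Matrix E E ℂ)) with hR'
  set S' : Bits n → Bits n → EuclideanSpace ℂ (B × E) →L[ℂ] EuclideanSpace ℂ (B × E) :=
    fun θ x => Matrix.toEuclideanCLM (n := B × E) (𝕜 := ℂ) ((1 : Matrix B B ℂ) ⊗ₖ S θ x) with hS'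
  have hcomm : ∀ (r : Matrix B B ℂ) (s : Matrix E E ℂ),
      Commute (Matrix.toEuclideanCLM (n := B × E) (𝕜 := ℂ) (r ⊗ₖ (1 : Matrix E E ℂ)))
        (Matrix.toEuclideanCLM (n := B × E) (𝕜 := ℂ) ((1 : Matrix B B ℂ) ⊗ₖ s)) := by
    intro r s
    refine Commute.map ?_ _
    change _ * _ = _ * _
    rw [← Matrix.mul_kronecker_mul, ← Matrix.mul_kronecker_mul]
    simp only [Matrix.mul_one, Matrix.one_mul]
  have hadj : ∀ θ x, ContinuousLinearMap.adjoint (R' θ x)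
      = Matrix.toEuclideanCLM (n := B × E) (𝕜 := ℂ) ((R θ x)ᴴ ⊗ₖ (1 : Matrix E E ℂ)) := by
    intro θ x
    rw [← ContinuousLinearMap.star_eq_adjoint, hR', ← map_star, Matrix.star_eq_conjTranspose,
      Matrix.conjTranspose_kronecker, Matrix.conjTranspose_one]
  have hRle : ∀ θ v, ∑ x, ‖R' θ x v‖ ^ 2 ≤ ‖v‖ ^ 2 := by
    intro θ
    refine sum_norm_sq_toEuclideanCLM_le (fun x => R θ x ⊗ₖ (1 : Matrix E E ℂ)) ?_
    have h1 : ∑ x, (R θ x ⊗ₖ (1 : Matrix E E ℂ))ᴴ * (R θ x ⊗ₖ (1 : Matrix E E ℂ)) = 1 := by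
      simp only [Matrix.conjTranspose_kronecker, ← Matrix.mul_kronecker_mul,
        Matrix.conjTranspose_one, Matrix.mul_one, ← hR]
      rw [← Matrix.one_kronecker_one, ← (P θ).sum_eq_one, ← Equiv.sum_comp σ fun y => (P θ).op y]
      ext ⟨b, e⟩ ⟨b', e'⟩
      simp only [Matrix.sum_apply, Matrix.kroneckerMap_apply, Finset.sum_mul]
    rw [h1, sub_self]
    exact Matrix.PosSemidef.zero
  have hSle : ∀ θ v, ∑ x, ‖S' θ x v‖ ^ 2 ≤ ‖v‖ ^ 2 := by
    intro θ
    refine sum_norm_sq_toEuclideanCLM_le (fun x => (1 : Matrix B B ℂ) ⊗ₖ S θ x) ?_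
    have h1 : 1 - ∑ x, ((1 : Matrix B B ℂ) ⊗ₖ S θ x)ᴴ * ((1 : Matrix B B ℂ) ⊗ₖ S θ x)
        = (1 : Matrix B B ℂ) ⊗ₖ (1 - ∑ x, M θ x) := by
      simp only [Matrix.conjTranspose_kronecker, ← Matrix.mul_kronecker_mul,
        Matrix.conjTranspose_one, Matrix.mul_one, ← hS]
      rw [← Matrix.one_kronecker_one]
      ext ⟨b, e⟩ ⟨b', e'⟩
      simp only [Matrix.sub_apply, Matrix.sum_apply, Matrix.kroneckerMap_apply, mul_sub,
        Finset.mul_sum]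
    rw [h1]
    exact Matrix.PosSemidef.one.kronecker (hM1 θ)
  have key := fun j => sum_game_le (fun θ x a => bb84Vec θ x a) R' S' hRle hSle
    (fun θ x => hcomm _ _) (fun θ x θ' z => by rw [hadj]; exact hcomm _ _)
    (fun θ θ' => overlapBound θ θ')
    (fun θ θ' => Finset.prod_nonneg fun i _ => by split_ifs <;> positivity)
    (fun θ θ' => by simp only [overlapBound, eq_comm])
    norm_sum_star_bb84Vec_mul_bb84Vec_le (C := (2 * betaZero) ^ n)
    (by unfold betaZero; positivity) (fun θ => (sum_overlapBound θ).le)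
    (fun a => WithLp.toLp 2 (A.vec j a))
  have hpost : ∀ θ x j, ∑ a, star (bb84Vec θ x a) • WithLp.toLp 2 (A.vec j a)
      = WithLp.toLp 2 (A.postVec θ x j) := by
    intro θ x j
    ext d
    simp only [WithLp.ofLp_sum, Finset.sum_apply, PiLp.smul_apply, smul_eq_mul, Attack.postVec]
  simp only [hpost] at key
  calc ∑ θ, ∑ x, (M θ x * eveState A P θ x (σ x)).trace.re
      = ∑ j, ∑ θ, ∑ x, ‖R' θ x (S' θ x (WithLp.toLp 2 (A.postVec θ x j)))‖ ^ 2 := by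
        symm
        rw [Finset.sum_comm]
        refine Finset.sum_congr rfl fun θ _ => ?_
        rw [Finset.sum_comm]
        refine Finset.sum_congr rfl fun x _ => ?_
        rw [hS θ x]
        exact (trace_mul_eveState A P θ x (σ x) (hR θ x) (S θ x)).symm
    _ ≤ ∑ j, (2 * betaZero) ^ n * ∑ a, ‖WithLp.toLp 2 (A.vec j a)‖ ^ 2 :=
        Finset.sum_le_sum fun j _ => key j
    _ = (2 * betaZero) ^ n := by
        rw [← Finset.mul_sum]
        simp only [EuclideanSpace.norm_sq_eq]
        rw [A.sum_norm_sq_vec, mul_one]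

/-- The monogamy game with an imperfect guess of Bob's device. Each error string `e` of relative
weight at most `q` gives a perfect game, won with probability at most `β₀ ^ n`. -/
lemma sum_trace_mul_eveState_le (hn : 0 < n) {q : ℝ} (hq0 : 0 < q) (hq1 : q ≤ 1 / 2)
    (A : Attack n B E) (P : Bits n → POVM (Bits n) B) (M : Bits n → Bits n → Matrix E E ℂ)
    (hM0 : ∀ θ x, (M θ x).PosSemidef) (hM1 : ∀ θ, (1 - ∑ x, M θ x).PosSemidef) :
    ∑ θ, ∑ x, ∑ y with relDist x y ≤ q, (M θ x * eveState A P θ x y).trace.re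
      ≤ (2 : ℝ) ^ (binEnt q * n) * (2 * betaZero) ^ n := by
  let τ : Bits n → Equiv.Perm (Bits n) := fun e =>
    ⟨fun x i => xor (x i) (e i), fun x i => xor (x i) (e i),
      fun x => by funext i; simp, fun x => by funext i; simp⟩
  have hτ : ∀ e x i, τ e x i = xor (x i) (e i) := fun _ _ _ => rfl
  have hdist : ∀ e x, relDist x (τ e x) ≤ q
      ↔ ((Finset.univ.filter fun i => e i = true).card : ℝ) ≤ q * n := by
    intro e x
    have h1 : hammingDist x (τ e x) = (Finset.univ.filter fun i => e i = true).card := by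
      rw [hammingDist]
      congr 1
      ext i
      simp only [Finset.mem_filter, Finset.mem_univ, true_and, hτ]
      cases x i <;> cases e i <;> simp
    rw [relDist, h1, div_le_iff₀ (by exact_mod_cast hn)]
  have hsum : ∀ θ x, ∑ y with relDist x y ≤ q, (M θ x * eveState A P θ x y).trace.re
      = ∑ e with ((Finset.univ.filter fun i => e i = true).card : ℝ) ≤ q * n,
          (M θ x * eveState A P θ x (τ e x)).trace.re := by
    intro θ x
    simp only [Finset.sum_filter, ← hdist _ x]
    let ρ : Equiv.Perm (Bits n) := ⟨fun e => τ e x, fun y => τ y x,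
      fun e => by funext i; simp [hτ], fun e => by funext i; simp [hτ]⟩
    exact (Equiv.sum_comp ρ fun y =>
      if relDist x y ≤ q then (M θ x * eveState A P θ x y).trace.re else 0).symm
  simp only [hsum]
  calc _ = ∑ e with ((Finset.univ.filter fun i => e i = true).card : ℝ) ≤ q * n,
        ∑ θ, ∑ x, (M θ x * eveState A P θ x (τ e x)).trace.re := by
        symm
        rw [Finset.sum_comm]
        refine Finset.sum_congr rfl fun θ _ => ?_
        rw [Finset.sum_comm]
    _ ≤ ∑ e : Bits n with ((Finset.univ.filter fun i => e i = true).card : ℝ) ≤ q * n,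
        (2 * betaZero) ^ n :=
        Finset.sum_le_sum fun e _ => sum_trace_mul_eveState_perm_le A P (τ e) M hM0 hM1
    _ ≤ _ := by
        rw [Finset.sum_const, nsmul_eq_mul]
        refine mul_le_mul_of_nonneg_right (card_hammingBall_le n hq0 hq1) ?_
        unfold betaZero
        positivity

end Guessing

/-! ### Trace distance of the key from uniform -/

section Distinguisher

variable {H : Type} [Fintype H] [DecidableEq H] {l : ℕ}

omit [Fintype H] [DecidableEq H] in
lemma traceFst_add {G : Type} [Fintype G] (σ σ' : Matrix (G × H) (G × H) ℂ) :
    traceFst (σ + σ') = traceFst σ + traceFst σ' := by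
  ext i j
  simp only [traceFst, Matrix.of_apply, Matrix.add_apply, Finset.sum_add_distrib]

omit [Fintype H] [DecidableEq H] in
lemma traceFst_smul {G : Type} [Fintype G] (r : ℂ) (σ : Matrix (G × H) (G × H) ℂ) :
    traceFst (r • σ) = r • traceFst σ := by
  ext i j
  simp only [traceFst, Matrix.of_apply, Matrix.smul_apply, smul_eq_mul, Finset.mul_sum]

omit [Fintype H] [DecidableEq H] in
lemma traceFst_sum {G X : Type} [Fintype G] (s : Finset X) (σ : X → Matrix (G × H) (G × H) ℂ) :
    traceFst (∑ x ∈ s, σ x) = ∑ x ∈ s, traceFst (σ x) := by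
  ext i j
  simp only [traceFst, Matrix.of_apply, Matrix.sum_apply]
  exact Finset.sum_comm

/-- The advantage of the test `M` in distinguishing the unnormalized state `σ` of key and
environment from a uniform key with the same environment. -/
def keyTest (M : Matrix (Option (Bits l) × H) (Option (Bits l) × H) ℂ) :
    Matrix (Option (Bits l) × H) (Option (Bits l) × H) ℂ →ₗ[ℂ] ℂ where
  toFun σ := (M * (σ - uniformKey l ⊗ₖ traceFst σ)).trace
  map_add' σ σ' := by
    rw [traceFst_add, Matrix.kronecker_add, add_sub_add_comm, Matrix.mul_add, Matrix.trace_add]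
  map_smul' r σ := by
    rw [traceFst_smul, Matrix.kronecker_smul, ← smul_sub, Matrix.mul_smul, Matrix.trace_smul]
    rfl

/-- The normalization in the definition of security cancels: it suffices to bound the advantages of
all tests on the unnormalized accepted state. -/
lemma isDeltaSecure_of_keyTest_le
    (ρ : Matrix (Option (Bits l) × H) (Option (Bits l) × H) ℂ) {δ : ℝ} (hδ : 0 ≤ δ)
    (h : ∀ M : Matrix (Option (Bits l) × H) (Option (Bits l) × H) ℂ, M.PosSemidef →
      (1 - M).PosSemidef →
      (keyTest M (eventProj (fun k => k ≠ none) * ρ * eventProj fun k => k ≠ none)).re ≤ δ) :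
    IsDeltaSecure ρ δ := by
  unfold IsDeltaSecure
  set p := prob ρ (fun k => k ≠ none) with hp
  -- for `p = 0` the conditional state is the junk value `0`, and the product vanishes anyway
  rcases le_or_gt p 0 with hp0 | hp0
  · refine le_trans (mul_nonpos_of_nonpos_of_nonneg hp0 ?_) hδ
    exact Real.sSup_nonneg' ⟨0, ⟨0, Matrix.PosSemidef.zero, by
      rw [sub_zero]; exact Matrix.PosSemidef.one, by simp⟩, le_rfl⟩
  · have hle : traceDist (condState ρ fun k => k ≠ none)
        (uniformKey l ⊗ₖ traceFst (condState ρ fun k => k ≠ none)) ≤ δ / p := by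
      refine csSup_le ⟨0, 0, Matrix.PosSemidef.zero, by
        rw [sub_zero]; exact Matrix.PosSemidef.one, by simp⟩ ?_
      rintro r ⟨M, hM0, hM1, rfl⟩
      change (keyTest M (condState ρ fun k => k ≠ none)).re ≤ _
      rw [condState, map_smul, ← hp, ← Complex.ofReal_inv, smul_eq_mul, Complex.re_ofReal_mul,
        le_div_iff₀ hp0]
      have := h M hM0 hM1
      field_simp
      exact this
    calc _ ≤ p * (δ / p) := mul_le_mul_of_nonneg_left hle hp0.le
      _ = δ := by field_simp

end Distinguisher

section Blocks

variable {K Ct E : Type} [Fintype K] [Fintype Ct] [Fintype E]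
  [DecidableEq K] [DecidableEq Ct] [DecidableEq E]

/-- The diagonal block of an operator at the values `k`, `c` of two classical registers. -/
def block (M : Matrix (K × Ct × E) (K × Ct × E) ℂ) (k : K) (c : Ct) : Matrix E E ℂ :=
  M.submatrix (fun e => (k, c, e)) (fun e => (k, c, e))

omit [Fintype K] [Fintype Ct] [Fintype E] [DecidableEq K] [DecidableEq Ct] [DecidableEq E] in
lemma block_posSemidef {M : Matrix (K × Ct × E) (K × Ct × E) ℂ} (hM : M.PosSemidef) (k : K)
    (c : Ct) : (block M k c).PosSemidef := hM.submatrix _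

omit [Fintype K] [Fintype Ct] [Fintype E] in
lemma one_sub_block_posSemidef {M : Matrix (K × Ct × E) (K × Ct × E) ℂ}
    (hM : (1 - M).PosSemidef) (k : K) (c : Ct) : (1 - block M k c).PosSemidef := by
  have h1 : 1 - block M k c = (1 - M).submatrix (fun e => (k, c, e)) (fun e => (k, c, e)) := by
    ext e e'
    simp [block, Matrix.one_apply]
  rw [h1]
  exact hM.submatrix _

omit [DecidableEq E] in
lemma trace_mul_diagonal_kronecker (M : Matrix (K × Ct × E) (K × Ct × E) ℂ) (d : K → ℂ) (c : Ct)
    (ω : Matrix E E ℂ) :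
    (M * (Matrix.diagonal d ⊗ₖ (Matrix.single c c (1 : ℂ) ⊗ₖ ω))).trace
      = ∑ k, d k * (block M k c * ω).trace := by
  simp only [Matrix.trace, Matrix.diag_apply, Matrix.mul_apply, Fintype.sum_prod_type,
    Matrix.kroneckerMap_apply, Matrix.diagonal_apply, Matrix.single_apply, block,
    Matrix.submatrix_apply]
  refine Finset.sum_congr rfl fun k _ => ?_
  rw [Finset.sum_eq_single c]
  · rw [Finset.mul_sum]
    refine Finset.sum_congr rfl fun e _ => ?_
    rw [Finset.sum_eq_single k, Finset.sum_eq_single c, Finset.mul_sum]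
    · refine Finset.sum_congr rfl fun e' _ => ?_
      simp
      ring
    · intro c' _ hc'
      simp [hc'.symm]
    · simp
    · intro k' _ hk'
      simp [hk']
    · simp
  · intro c' _ hc'
    simp [hc'.symm]
  · simp

end Blocks

section KeyTest

variable {Ct E : Type} [Fintype Ct] [Fintype E] [DecidableEq Ct] [DecidableEq E] {l : ℕ}

lemma traceFst_single_kronecker {G H : Type} [Fintype G] [DecidableEq G] (g : G)
    (N : Matrix H H ℂ) : traceFst (Matrix.single g g (1 : ℂ) ⊗ₖ N) = N := by
  ext i j
  simp [traceFst, Matrix.single_apply]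

omit [DecidableEq E] in
lemma keyTest_single (M : Matrix (Option (Bits l) × Ct × E) (Option (Bits l) × Ct × E) ℂ)
    (k : Bits l) (c : Ct) (ω : Matrix E E ℂ) :
    (keyTest M (Matrix.single (some k) (some k) (1 : ℂ) ⊗ₖ
        (Matrix.single c c (1 : ℂ) ⊗ₖ ω))).re
      = (block M (some k) c * ω).trace.re
        - (2 ^ l)⁻¹ * ∑ k', (block M (some k') c * ω).trace.re := by
  change (M * (_ - _)).trace.re = _
  rw [traceFst_single_kronecker, Matrix.mul_sub, Matrix.trace_sub, Complex.sub_re, uniformKey,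
    trace_mul_diagonal_kronecker, ← Matrix.diagonal_single, trace_mul_diagonal_kronecker]
  congr 1
  · rw [Finset.sum_eq_single (some k)]
    · simp
    · intro k' _ hk'
      simp [hk']
    · simp
  · rw [Fintype.sum_option]
    simp only [if_true, zero_mul, zero_add, reduceCtorEq, if_false]
    rw [← Finset.mul_sum, ← Complex.re_sum]
    have : ((2 : ℂ) ^ l)⁻¹ = (((2 ^ l)⁻¹ : ℝ) : ℂ) := by push_cast; rfl
    rw [this, Complex.re_ofReal_mul]

lemma eventProj_mul_single_mul {K H : Type} [Fintype K] [DecidableEq K] [Fintype H]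
    [DecidableEq H] (lam : K → Prop) [DecidablePred lam] (k : K) (N : Matrix H H ℂ) :
    eventProj lam * (Matrix.single k k (1 : ℂ) ⊗ₖ N) * eventProj lam
      = if lam k then Matrix.single k k (1 : ℂ) ⊗ₖ N else 0 := by
  rw [eventProj, ← Matrix.mul_kronecker_mul, ← Matrix.mul_kronecker_mul, Matrix.one_mul,
    Matrix.mul_one]
  have h : Matrix.diagonal (fun k => if lam k then (1 : ℂ) else 0) * Matrix.single k k 1 *
      Matrix.diagonal (fun k => if lam k then (1 : ℂ) else 0)
      = if lam k then Matrix.single k k 1 else 0 := by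
    ext i j
    rw [Matrix.mul_diagonal, Matrix.diagonal_mul, Matrix.single_apply]
    by_cases hi : k = i
    · subst hi
      by_cases hj : k = j
      · subst hj
        by_cases hl : lam k <;> simp [hl]
      · by_cases hl : lam k <;> simp [hl, hj]
    · by_cases hl : lam k <;> simp [hl, hi]
  rw [h]
  split_ifs
  · rfl
  · exact Matrix.zero_kronecker _

end KeyTest

/-! ### The test statistics of the sample -/

lemma hammingDist_onSample {n t : ℕ} (T : Sample n t) (x y : Bits n) :
    hammingDist (onSample T x) (onSample T y)
      = (T.1 ∩ Finset.univ.filter fun i => x i ≠ y i).card := by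
  rw [hammingDist]
  refine Finset.card_bij (fun i _ => T.1.orderEmbOfFin T.2 i) ?_ ?_ ?_
  · intro i hi
    simp only [Finset.mem_inter, Finset.mem_filter, Finset.mem_univ, true_and] at hi ⊢
    exact ⟨Finset.orderEmbOfFin_mem _ _ _, hi⟩
  · intro i _ j _ h
    exact (T.1.orderEmbOfFin T.2).injective h
  · intro b hb
    simp only [Finset.mem_inter, Finset.mem_filter, Finset.mem_univ, true_and] at hb
    have : b ∈ Set.range (T.1.orderEmbOfFin T.2) := by
      rw [Finset.range_orderEmbOfFin]
      exact hb.1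
    obtain ⟨i, rfl⟩ := this
    refine ⟨i, ?_, rfl⟩
    exact Finset.mem_filter.2 ⟨Finset.mem_univ _, hb.2⟩

/-- Strings are determined by their restrictions to a sample and to its complement. -/
lemma eq_of_onSample_eq_of_offSample_eq {n t : ℕ} (T : Sample n t) {x y : Bits n}
    (h1 : onSample T x = onSample T y) (h2 : offSample T x = offSample T y) : x = y := by
  funext i
  by_cases hi : i ∈ T.1
  · have : i ∈ Set.range (T.1.orderEmbOfFin T.2) := by
      rw [Finset.range_orderEmbOfFin]
      exact hi
    obtain ⟨j, rfl⟩ := this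
    exact congrFun h1 j
  · have : i ∈ Set.range ((T.1ᶜ).orderEmbOfFin T.card_compl) := by
      rw [Finset.range_orderEmbOfFin]
      simpa using hi
    obtain ⟨j, rfl⟩ := this
    exact congrFun h2 j

/-- Strings that differ by more than a fraction `γ + ε` pass the test on the sample with probability
at most `e^{-2ε²t}`. -/
lemma card_accepted_le {n t : ℕ} (ht : 0 < t) (htn : t < n) {γ ε : ℝ} (hε : 0 < ε) (x y : Bits n)
    (hxy : γ + ε < relDist x y) :
    ((Finset.univ.filter fun T : Sample n t =>
        ¬ γ < relDist (onSample T x) (onSample T y)).card : ℝ)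
      ≤ Fintype.card (Sample n t) * Real.exp (-2 * ε ^ 2 * t) := by
  have hcard : Fintype.card (Sample n t) = n.choose t := by
    rw [Fintype.card_finset_len, Fintype.card_fin]
  rw [hcard]
  refine le_trans (le_of_eq ?_) (card_filter_inter_card_le (by omega) htn.le
    (Finset.univ.filter fun i => x i ≠ y i) hε hxy)
  norm_cast
  refine Finset.card_bij (fun T _ => T.1) ?_ ?_ ?_
  · intro T hT
    simp only [Finset.mem_filter, Finset.mem_univ, true_and, relDist, hammingDist_onSample,
      not_lt] at hT
    rw [div_le_iff₀ (by exact_mod_cast ht)] at hT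
    exact Finset.mem_filter.2 ⟨Finset.mem_powersetCard.2 ⟨Finset.subset_univ _, T.2⟩, hT⟩
  · intro T _ T' _ h
    exact Subtype.ext h
  · intro T hT
    rw [Finset.mem_filter, Finset.mem_powersetCard] at hT
    refine ⟨⟨T, hT.1.2⟩, ?_, rfl⟩
    simp only [Finset.mem_filter, Finset.mem_univ, true_and, relDist, hammingDist_onSample,
      not_lt]
    rw [div_le_iff₀ (by exact_mod_cast ht)]
    exact hT.2

/-! ### Security of the key -/

/-- Privacy amplification with classical side information `c x`. Publishing `c x` raises the
guessing probability `G` by at most a factor `#Cc`: without `c x` its value can be guessed first. -/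
lemma privacy_amplification {Θ X Cc ι K H : Type} [Fintype Θ] [Fintype X] [DecidableEq X]
    [Fintype Cc] [DecidableEq Cc] [Nonempty Cc] [Fintype ι] [Fintype K] [DecidableEq K]
    [Nonempty K] [Fintype H] [DecidableEq H] (c : X → Cc) (ω : Θ → X → Matrix H H ℂ)
    (hω : ∀ θ x, (ω θ x).PosSemidef) (F : ι → X → K)
    (hF : ∀ x x', c x = c x' → x ≠ x' →
      ((Finset.univ.filter fun f => F f x = F f x').card : ℝ)
        ≤ Fintype.card ι / Fintype.card K)
    (Q : Θ → Cc → ι → K → Matrix H H ℂ) (hQ0 : ∀ θ z f k, (Q θ z f k).PosSemidef)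
    (hQ1 : ∀ θ z f k, (1 - Q θ z f k).PosSemidef) {G W : ℝ}
    (hG : ∀ M : Θ → X → Matrix H H ℂ, (∀ θ x, (M θ x).PosSemidef) →
      (∀ θ, (1 - ∑ x, M θ x).PosSemidef) → ∑ θ, ∑ x, (M θ x * ω θ x).trace.re ≤ G)
    (hW : ∑ θ, ∑ x, (ω θ x).trace.re ≤ W) :
    ∑ θ, ∑ f, ∑ x, ((Q θ (c x) f (F f x) * ω θ x).trace.re
        - (Fintype.card K : ℝ)⁻¹ * ∑ k, (Q θ (c x) f k * ω θ x).trace.re)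
      ≤ Fintype.card ι / 2 * √(Fintype.card K * (W * (Fintype.card Cc * G))) := by
  have hc0 : (0 : ℝ) < Fintype.card Cc := by exact_mod_cast Fintype.card_pos
  choose M hM0 hM1 hM using fun θ z => exists_subPOVM_sum_trace_le
    (Finset.univ.filter fun x => c x = z) (ω θ) (hω θ) F
    (fun x hx x' hx' => hF x x'
      ((Finset.mem_filter.1 hx).2.trans (Finset.mem_filter.1 hx').2.symm)) (Q θ z)
    (hQ0 θ z) (hQ1 θ z)
  set τ : Θ × Cc → ℝ := fun p => (∑ x with c x = p.2, ω p.1 x).trace.re with hτ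
  set Γ : Θ × Cc → ℝ := fun p => ∑ x with c x = p.2, (M p.1 p.2 x * ω p.1 x).trace.re with hΓ
  have hτ0 : ∀ p, 0 ≤ τ p := fun p =>
    (Complex.nonneg_iff.1 (Matrix.posSemidef_sum _ fun x _ => hω p.1 x).trace_nonneg).1
  have hΓ0 : ∀ p, 0 ≤ Γ p := fun p =>
    Finset.sum_nonneg fun x _ => trace_mul_nonneg (hM0 p.1 p.2 x) (hω p.1 x)
  have hfib : ∀ θ z f, ∑ k, (Q θ z f k * ((∑ x ∈ Finset.univ.filter (fun x => c x = z) with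
        F f x = k, ω θ x) - (Fintype.card K : ℂ)⁻¹ • ∑ x with c x = z, ω θ x)).trace.re
      = ∑ x with c x = z, ((Q θ (c x) f (F f x) * ω θ x).trace.re
        - (Fintype.card K : ℝ)⁻¹ * ∑ k, (Q θ (c x) f k * ω θ x).trace.re) := by
    intro θ z f
    have h1 : ∀ k, (Q θ z f k * ((∑ x ∈ Finset.univ.filter (fun x => c x = z) with
        F f x = k, ω θ x) - (Fintype.card K : ℂ)⁻¹ • ∑ x with c x = z, ω θ x)).trace.re
        = ∑ x ∈ Finset.univ.filter (fun x => c x = z) with F f x = k,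
            (Q θ z f (F f x) * ω θ x).trace.re
          - (Fintype.card K : ℝ)⁻¹ * ∑ x with c x = z, (Q θ z f k * ω θ x).trace.re := by
      intro k
      have h2 : (Fintype.card K : ℂ)⁻¹ = (((Fintype.card K : ℝ)⁻¹ : ℝ) : ℂ) := by
        push_cast; rfl
      rw [Matrix.mul_sub, Matrix.trace_sub, Complex.sub_re, Matrix.mul_smul, Matrix.trace_smul,
        h2, smul_eq_mul, Complex.re_ofReal_mul, Finset.mul_sum, Finset.mul_sum, Matrix.trace_sum,
        Matrix.trace_sum, Complex.re_sum, Complex.re_sum]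
      congr 1
      refine Finset.sum_congr rfl fun x hx => ?_
      rw [(Finset.mem_filter.1 hx).2]
    simp only [h1, Finset.sum_sub_distrib, ← Finset.mul_sum]
    rw [Finset.sum_fiberwise, Finset.sum_comm]
    congr 1
    · refine Finset.sum_congr rfl fun x hx => ?_
      rw [(Finset.mem_filter.1 hx).2]
    · congr 1
      refine Finset.sum_congr rfl fun x hx => ?_
      rw [(Finset.mem_filter.1 hx).2]
  have hsplit : ∑ θ, ∑ f, ∑ x, ((Q θ (c x) f (F f x) * ω θ x).trace.re
        - (Fintype.card K : ℝ)⁻¹ * ∑ k, (Q θ (c x) f k * ω θ x).trace.re)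
      ≤ ∑ p : Θ × Cc, Fintype.card ι / 2 * √(Fintype.card K * τ p * Γ p) := by
    rw [Fintype.sum_prod_type]
    refine Finset.sum_le_sum fun θ _ => ?_
    refine le_trans (le_of_eq ?_) (Finset.sum_le_sum fun z _ => hM θ z)
    rw [Finset.sum_comm (s := (Finset.univ : Finset Cc))]
    refine Finset.sum_congr rfl fun f _ => ?_
    simp only [hfib]
    rw [Finset.sum_fiberwise]
  have hτsum : ∑ p, τ p ≤ W := by
    refine le_trans (le_of_eq ?_) hW
    rw [Fintype.sum_prod_type]
    refine Finset.sum_congr rfl fun θ _ => ?_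
    simp only [hτ, Matrix.trace_sum, Complex.re_sum]
    rw [Finset.sum_fiberwise]
  have hΓsum : ∑ p, Γ p ≤ Fintype.card Cc * G := by
    have hr0 : (0 : ℂ) ≤ (((Fintype.card Cc : ℝ)⁻¹ : ℝ) : ℂ) :=
      Complex.zero_le_real.2 (by positivity)
    -- guess `c x` uniformly, then measure `M θ (c x)`
    have h := hG (fun θ x => (((Fintype.card Cc : ℝ)⁻¹ : ℝ) : ℂ) • M θ (c x) x)
      (fun θ x => (hM0 θ (c x) x).smul hr0) (fun θ => by
        have h1 : 1 - ∑ x, (((Fintype.card Cc : ℝ)⁻¹ : ℝ) : ℂ) • M θ (c x) x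
            = ∑ z, (((Fintype.card Cc : ℝ)⁻¹ : ℝ) : ℂ) • (1 - ∑ x with c x = z, M θ z x) := by
          simp only [smul_sub, Finset.sum_sub_distrib, Finset.sum_const, Finset.card_univ,
            Finset.smul_sum]
          congr 1
          · rw [← Nat.cast_smul_eq_nsmul ℂ, smul_smul]
            have : (Fintype.card Cc : ℂ) * (((Fintype.card Cc : ℝ)⁻¹ : ℝ) : ℂ) = 1 := by
              push_cast
              exact mul_inv_cancel₀ (by exact_mod_cast hc0.ne')
            rw [this, one_smul]
          · rw [← Finset.sum_fiberwise Finset.univ c]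
            refine Finset.sum_congr rfl fun z _ => Finset.sum_congr rfl fun x hx => ?_
            rw [(Finset.mem_filter.1 hx).2]
        rw [h1]
        exact Matrix.posSemidef_sum _ fun z _ => (hM1 θ z).smul hr0)
    have h2 : ∑ θ, ∑ x, (((((Fintype.card Cc : ℝ)⁻¹ : ℝ) : ℂ) • M θ (c x) x) * ω θ x).trace.re
        = (Fintype.card Cc : ℝ)⁻¹ * ∑ p, Γ p := by
      rw [Fintype.sum_prod_type, Finset.mul_sum]
      refine Finset.sum_congr rfl fun θ _ => ?_
      rw [← Finset.sum_fiberwise Finset.univ c, Finset.mul_sum]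
      refine Finset.sum_congr rfl fun z _ => ?_
      rw [Finset.mul_sum]
      refine Finset.sum_congr rfl fun x hx => ?_
      rw [(Finset.mem_filter.1 hx).2, Matrix.smul_mul, Matrix.trace_smul, smul_eq_mul,
        Complex.re_ofReal_mul]
    rw [h2, inv_mul_le_iff₀ hc0] at h
    exact h
  have hW0 : 0 ≤ W := (Finset.sum_nonneg fun p _ => hτ0 p).trans hτsum
  refine hsplit.trans ?_
  rw [← Finset.mul_sum]
  refine mul_le_mul_of_nonneg_left ?_ (by positivity)
  calc ∑ p, √(Fintype.card K * τ p * Γ p)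
      = √(Fintype.card K) * ∑ p, √(τ p) * √(Γ p) := by
        rw [Finset.mul_sum]
        refine Finset.sum_congr rfl fun p _ => ?_
        rw [mul_assoc, Real.sqrt_mul (by positivity), Real.sqrt_mul (hτ0 p)]
    _ ≤ √(Fintype.card K) * (√(∑ p, √(τ p) ^ 2) * √(∑ p, √(Γ p) ^ 2)) :=
        mul_le_mul_of_nonneg_left (sum_mul_le_sqrt_sum_mul_sqrt_sum _ _ _) (Real.sqrt_nonneg _)
    _ ≤ √(Fintype.card K) * (√W * √(Fintype.card Cc * G)) := by
        simp only [Real.sq_sqrt (hτ0 _), Real.sq_sqrt (hΓ0 _)]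
        gcongr
    _ = _ := by
        rw [Real.sqrt_mul (by positivity : (0 : ℝ) ≤ Fintype.card K), Real.sqrt_mul hW0]

section Protocol

variable {n t s l : ℕ} {ι B E : Type} [Fintype ι] [DecidableEq ι]
  [Fintype B] [DecidableEq B] [Fintype E] [DecidableEq E]

lemma keyEveState_eq (γ : ℝ) (C : PostProcessing n t s l ι) (A : Attack n B E)
    (P : Bits n → POVM (Bits n) B) :
    keyEveState γ C A P = ∑ θ : Bits n, ∑ T : Sample n t, ∑ f : ι, ∑ x : Bits n, ∑ y : Bits n,
    ((Fintype.card (Bits n) : ℂ)⁻¹ * (Fintype.card (Sample n t) : ℂ)⁻¹ *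
        (Fintype.card ι : ℂ)⁻¹) •
        (Matrix.single (aliceKey γ C T f x y) (aliceKey γ C T f x y) (1 : ℂ) ⊗ₖ
          (Matrix.single (transcript γ C θ T f x y) (transcript γ C θ T f x y) (1 : ℂ) ⊗ₖ
            eveState A P θ x y)) := by
  rw [keyEveState, finalState]
  simp only [traceFst_sum, traceFst_smul, traceFst_single_kronecker]

/-- The advantage of the test `M` if the protocol is run with `θ`, `T`, `f`, Alice obtains `x` and
Eve's conditional state is `ω`. -/
def advantage (C : PostProcessing n t s l ι)
    (M : Matrix (Option (Bits l) × Transcript n t s ι × E)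
      (Option (Bits l) × Transcript n t s ι × E) ℂ)
    (θ : Bits n) (T : Sample n t) (f : ι) (x : Bits n) (ω : Matrix E E ℂ) : ℝ :=
  (block M (some (C.hash f (offSample T x)))
      ((θ, T), (onSample T x, some (C.syndrome (offSample T x), f))) * ω).trace.re
    - (2 ^ l)⁻¹ * ∑ k, (block M (some k)
      ((θ, T), (onSample T x, some (C.syndrome (offSample T x), f))) * ω).trace.re

omit [Fintype ι] [DecidableEq ι] [DecidableEq E] in
lemma advantage_sum (C : PostProcessing n t s l ι)
    (M : Matrix (Option (Bits l) × Transcript n t s ι × E)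
      (Option (Bits l) × Transcript n t s ι × E) ℂ)
    (θ : Bits n) (T : Sample n t) (f : ι) (x : Bits n) {Y : Type} (Ys : Finset Y)
    (ω : Y → Matrix E E ℂ) :
    advantage C M θ T f x (∑ y ∈ Ys, ω y) = ∑ y ∈ Ys, advantage C M θ T f x (ω y) := by
  simp only [advantage, Finset.mul_sum, Matrix.trace_sum, Complex.re_sum, Finset.sum_sub_distrib]
  congr 1
  rw [Finset.sum_comm]

omit [Fintype ι] in
lemma advantage_le_trace (C : PostProcessing n t s l ι)
    {M : Matrix (Option (Bits l) × Transcript n t s ι × E)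
      (Option (Bits l) × Transcript n t s ι × E) ℂ} (hM0 : M.PosSemidef)
    (hM1 : (1 - M).PosSemidef)
    (θ : Bits n) (T : Sample n t) (f : ι) (x : Bits n) {ω : Matrix E E ℂ} (hω : ω.PosSemidef) :
    advantage C M θ T f x ω ≤ ω.trace.re := by
  unfold advantage
  have h1 := trace_mul_le_trace (one_sub_block_posSemidef hM1
    (some (C.hash f (offSample T x)))
      ((θ, T), (onSample T x, some (C.syndrome (offSample T x), f)))) hω
  have h2 : 0 ≤ ((2 : ℝ) ^ l)⁻¹ * ∑ k, (block M (some k)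
      ((θ, T), (onSample T x, some (C.syndrome (offSample T x), f))) * ω).trace.re :=
    mul_nonneg (by positivity) (Finset.sum_nonneg fun k _ =>
      trace_mul_nonneg (block_posSemidef hM0 _ _) hω)
  linarith

lemma keyTest_keyEveState (γ : ℝ) (C : PostProcessing n t s l ι) (A : Attack n B E)
    (P : Bits n → POVM (Bits n) B)
    (M : Matrix (Option (Bits l) × Transcript n t s ι × E)
      (Option (Bits l) × Transcript n t s ι × E) ℂ) :
    (keyTest M (eventProj (fun k => k ≠ none) * keyEveState γ C A P *
        eventProj fun k => k ≠ none)).re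
      = ((Fintype.card (Bits n) : ℝ)⁻¹ * (Fintype.card (Sample n t) : ℝ)⁻¹ *
          (Fintype.card ι : ℝ)⁻¹) * ∑ θ : Bits n, ∑ T : Sample n t, ∑ f : ι, ∑ x : Bits n,
          ∑ y with ¬ γ < relDist (onSample T x) (onSample T y),
            advantage C M θ T f x (eveState A P θ x y) := by
  have hw : ((Fintype.card (Bits n) : ℂ)⁻¹ * (Fintype.card (Sample n t) : ℂ)⁻¹ *
        (Fintype.card ι : ℂ)⁻¹) = (((Fintype.card (Bits n) : ℝ)⁻¹ *
          (Fintype.card (Sample n t) : ℝ)⁻¹ * (Fintype.card ι : ℝ)⁻¹ : ℝ) : ℂ) := by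
    push_cast; rfl
  rw [keyEveState_eq]
  simp only [Finset.mul_sum, Finset.sum_mul, Matrix.mul_smul, Matrix.smul_mul,
    eventProj_mul_single_mul, map_sum, map_smul, Complex.re_sum, Finset.sum_filter, hw,
    smul_eq_mul, Complex.re_ofReal_mul]
  refine Finset.sum_congr rfl fun θ _ => Finset.sum_congr rfl fun T _ =>
    Finset.sum_congr rfl fun f _ => Finset.sum_congr rfl fun x _ =>
    Finset.sum_congr rfl fun y _ => ?_
  congr 1
  by_cases h : γ < relDist (onSample T x) (onSample T y)
  · simp [h, aliceKey]
  · rw [if_pos h]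
    have hk : aliceKey γ C T f x y = some (C.hash f (offSample T x)) := by simp [aliceKey, h]
    have hc : transcript γ C θ T f x y
        = ((θ, T), (onSample T x, some (C.syndrome (offSample T x), f))) := by
      simp [transcript, h]
    rw [hk, hc, if_pos (by simp), keyTest_single, advantage]

/-- The runs in which the strings of Alice and Bob's device are close: the monogamy game bounds
Eve's probability of guessing Alice's string, and privacy amplification applies. -/
lemma sum_advantage_close_le (hn : 0 < n) {γ ε : ℝ} (hγε0 : 0 < γ + ε) (hγε1 : γ + ε ≤ 1 / 2)
    (C : PostProcessing n t s l ι) [Nonempty ι] (hC : IsUniversalTwo C.hash) (A : Attack n B E)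
    (P : Bits n → POVM (Bits n) B)
    {M : Matrix (Option (Bits l) × Transcript n t s ι × E)
      (Option (Bits l) × Transcript n t s ι × E) ℂ} (hM0 : M.PosSemidef)
    (hM1 : (1 - M).PosSemidef) (T : Sample n t) :
    ∑ θ : Bits n, ∑ f : ι, ∑ x : Bits n,
        ∑ y with ¬ γ < relDist (onSample T x) (onSample T y) ∧ relDist x y ≤ γ + ε,
          advantage C M θ T f x (eveState A P θ x y)
      ≤ Fintype.card ι / 2 * √(2 ^ l * (2 ^ n * (2 ^ (t + s) *
          ((2 : ℝ) ^ (binEnt (γ + ε) * n) * (2 * betaZero) ^ n)))) := by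
  set ω : Bits n → Bits n → Matrix E E ℂ := fun θ x =>
    ∑ y with ¬ γ < relDist (onSample T x) (onSample T y) ∧ relDist x y ≤ γ + ε,
      eveState A P θ x y with hωdef
  have hK : (Fintype.card (Bits l) : ℝ) = 2 ^ l := by simp
  have hcc : (Fintype.card (Bits t × Bits s) : ℝ) = 2 ^ (t + s) := by simp [pow_add]
  have h := privacy_amplification (fun x : Bits n => (onSample T x, C.syndrome (offSample T x))) ω
    (fun θ x => Matrix.posSemidef_sum _ fun y _ => eveState_posSemidef A P θ x y)
    (fun f x => C.hash f (offSample T x)) ?_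
    (fun θ z f k => block M (some k) ((θ, T), (z.1, some (z.2, f))))
    (fun θ z f k => block_posSemidef hM0 _ _) (fun θ z f k => one_sub_block_posSemidef hM1 _ _)
    (G := (2 : ℝ) ^ (binEnt (γ + ε) * n) * (2 * betaZero) ^ n) (W := 2 ^ n) ?_ ?_
  · rw [hK, hcc] at h
    simp only [← advantage_sum]
    exact h
  · intro x x' hxx' hne
    have hoff : offSample T x ≠ offSample T x' := fun h =>
      hne (eq_of_onSample_eq_of_offSample_eq T (congrArg Prod.fst hxx') h)
    have h1 := hC _ _ hoff
    rw [Nat.card_eq_fintype_card, Fintype.card_subtype,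
      div_le_iff₀ (by exact_mod_cast Fintype.card_pos)] at h1
    rw [hK]
    calc _ ≤ _ := h1
      _ = _ := by ring
  · intro M' hM'0 hM'1
    refine le_trans ?_ (sum_trace_mul_eveState_le hn hγε0 hγε1 A P M' hM'0 hM'1)
    refine Finset.sum_le_sum fun θ _ => Finset.sum_le_sum fun x _ => ?_
    rw [hωdef, Finset.mul_sum, Matrix.trace_sum, Complex.re_sum]
    refine Finset.sum_le_sum_of_subset_of_nonneg ?_ fun y _ _ =>
      trace_mul_nonneg (hM'0 θ x) (eveState_posSemidef A P θ x y)
    intro y hy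
    exact Finset.mem_filter.2 ⟨Finset.mem_univ _, (Finset.mem_filter.1 hy).2.2⟩
  · have h1 : ∀ θ, ∑ x, (ω θ x).trace.re ≤ 1 := by
      intro θ
      rw [← sum_trace_eveState A P θ]
      refine Finset.sum_le_sum fun x _ => ?_
      rw [hωdef, Matrix.trace_sum, Complex.re_sum]
      exact Finset.sum_le_sum_of_subset_of_nonneg (Finset.subset_univ _) fun y _ _ =>
        (Complex.nonneg_iff.1 (eveState_posSemidef A P θ x y).trace_nonneg).1
    calc ∑ θ, ∑ x, (ω θ x).trace.re ≤ ∑ _θ : Bits n, (1 : ℝ) :=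
          Finset.sum_le_sum fun θ _ => h1 θ
      _ = 2 ^ n := by simp

omit [Fintype ι] in
/-- The runs in which the strings of Alice and Bob's device are far apart but pass the test. -/
lemma sum_advantage_far_le (ht : 0 < t) (htn : t < n) {γ ε : ℝ} (hε : 0 < ε)
    (C : PostProcessing n t s l ι) (A : Attack n B E) (P : Bits n → POVM (Bits n) B)
    {M : Matrix (Option (Bits l) × Transcript n t s ι × E)
      (Option (Bits l) × Transcript n t s ι × E) ℂ} (hM0 : M.PosSemidef)
    (hM1 : (1 - M).PosSemidef) (θ : Bits n) (f : ι) :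
    ∑ T : Sample n t, ∑ x : Bits n,
        ∑ y with ¬ γ < relDist (onSample T x) (onSample T y) ∧ ¬ relDist x y ≤ γ + ε,
          advantage C M θ T f x (eveState A P θ x y)
      ≤ Fintype.card (Sample n t) * Real.exp (-2 * ε ^ 2 * t) := by
  have htr0 : ∀ x y, 0 ≤ (eveState A P θ x y).trace.re := fun x y =>
    (Complex.nonneg_iff.1 (eveState_posSemidef A P θ x y).trace_nonneg).1
  calc _ ≤ ∑ T : Sample n t, ∑ x : Bits n, ∑ y,
        if ¬ γ < relDist (onSample T x) (onSample T y) ∧ ¬ relDist x y ≤ γ + ε then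
          (eveState A P θ x y).trace.re else 0 := by
        refine Finset.sum_le_sum fun T _ => Finset.sum_le_sum fun x _ => ?_
        rw [← Finset.sum_filter]
        exact Finset.sum_le_sum fun y _ =>
          advantage_le_trace C hM0 hM1 θ T f x (eveState_posSemidef A P θ x y)
    _ = ∑ x : Bits n, ∑ y : Bits n, ∑ T : Sample n t,
        if ¬ γ < relDist (onSample T x) (onSample T y) ∧ ¬ relDist x y ≤ γ + ε then
          (eveState A P θ x y).trace.re else 0 := by
        rw [Finset.sum_comm]
        exact Finset.sum_congr rfl fun x _ => Finset.sum_comm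
    _ ≤ ∑ x : Bits n, ∑ y : Bits n, Fintype.card (Sample n t) * Real.exp (-2 * ε ^ 2 * t) *
          (eveState A P θ x y).trace.re := by
        refine Finset.sum_le_sum fun x _ => Finset.sum_le_sum fun y _ => ?_
        by_cases hxy : relDist x y ≤ γ + ε
        · simp only [hxy, not_true_eq_false, and_false, if_false, Finset.sum_const_zero]
          have := htr0 x y
          positivity
        · simp only [hxy, not_false_eq_true, and_true]
          rw [← Finset.sum_filter, Finset.sum_const, nsmul_eq_mul]
          exact mul_le_mul_of_nonneg_right
            (card_accepted_le ht htn hε x y (not_le.1 hxy)) (htr0 x y)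
    _ = _ := by
        simp only [← Finset.mul_sum]
        rw [sum_trace_eveState, mul_one]

lemma half_sqrt_eq_rpow (n t s l : ℕ) (q : ℝ) :
    1 / 2 * √(2 ^ l * (2 ^ (t + s) * ((2 : ℝ) ^ (binEnt q * n) * betaZero ^ n)))
      = (2 : ℝ) ^ (-(1 / 2 : ℝ) *
        (Real.logb 2 (1 / betaZero) * n - binEnt q * n - l - t - s + 2)) := by
  have hβ : 0 < betaZero := by unfold betaZero; positivity
  have h1 : betaZero ^ n = (2 : ℝ) ^ (-(Real.logb 2 (1 / betaZero) * n)) := by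
    rw [← neg_mul, Real.rpow_mul two_pos.le, Real.rpow_natCast, one_div, Real.logb_inv, neg_neg,
      Real.rpow_logb two_pos (by norm_num) hβ]
  have h2 : (1 / 2 : ℝ) = (2 : ℝ) ^ (-1 : ℝ) := by rw [Real.rpow_neg_one]; norm_num
  rw [h1, ← Real.rpow_natCast, ← Real.rpow_natCast, ← Real.rpow_add two_pos,
    ← Real.rpow_add two_pos, ← Real.rpow_add two_pos, Real.sqrt_eq_rpow,
    ← Real.rpow_mul two_pos.le]
  nth_rewrite 1 [h2]
  rw [← Real.rpow_add two_pos]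
  congr 1
  push_cast
  ring

/-- Security for all finite sizes: the far runs cost `e^{-2ε²t}`, the close runs the second term of
the error bound. -/
theorem oneSidedSecure_errorBound {n t s l : ℕ} {γ ε : ℝ} (ht : 0 < t) (htn : t < n)
    (hγ : 0 ≤ γ) (hε : 0 < ε) (hγε : γ + ε ≤ 1 / 2) :
    OneSidedSecure n t s l γ (errorBound n t s l γ ε) := by
  intro ι _ _ _ C hC B E _ _ _ _ A P
  have hβ : 0 < betaZero := by unfold betaZero; positivity
  have hbound0 : 0 ≤ errorBound n t s l γ ε := by unfold errorBound; positivity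
  refine isDeltaSecure_of_keyTest_le _ hbound0 fun M hM0 hM1 => ?_
  rw [keyTest_keyEveState]
  set R : ℝ := (2 : ℝ) ^ (-(1 / 2 : ℝ) *
        (Real.logb 2 (1 / betaZero) * n - binEnt (γ + ε) * n - l - t - s + 2)) with hR
  have hS : 0 < Fintype.card (Sample n t) := by
    rw [Fintype.card_finset_len, Fintype.card_fin]
    exact Nat.choose_pos htn.le
  have hS' : (0 : ℝ) < Fintype.card (Sample n t) := by exact_mod_cast hS
  have hι : (0 : ℝ) < Fintype.card ι := by exact_mod_cast Fintype.card_pos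
  have hB : (Fintype.card (Bits n) : ℝ) = 2 ^ n := by simp
  have hsq : √(2 ^ l * (2 ^ n * (2 ^ (t + s) *
          ((2 : ℝ) ^ (binEnt (γ + ε) * n) * (2 * betaZero) ^ n)))) = 2 ^ n * (2 * R) := by
    have h1 : (2 : ℝ) ^ l * (2 ^ n * (2 ^ (t + s) *
          ((2 : ℝ) ^ (binEnt (γ + ε) * n) * (2 * betaZero) ^ n)))
        = (2 ^ n) ^ 2 * (2 ^ l * (2 ^ (t + s) * ((2 : ℝ) ^ (binEnt (γ + ε) * n) *
            betaZero ^ n))) := by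
      rw [mul_pow]; ring
    rw [h1, Real.sqrt_mul (by positivity), Real.sqrt_sq (by positivity), hR,
      ← half_sqrt_eq_rpow]
    ring
  have hclose : ∑ T : Sample n t, ∑ θ : Bits n, ∑ f : ι, ∑ x : Bits n,
        ∑ y with ¬ γ < relDist (onSample T x) (onSample T y) ∧ relDist x y ≤ γ + ε,
          advantage C M θ T f x (eveState A P θ x y)
      ≤ Fintype.card (Sample n t) * (Fintype.card ι * (2 ^ n * R)) := by
    calc _ ≤ ∑ _T : Sample n t, Fintype.card ι / 2 * (2 ^ n * (2 * R)) := by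
          refine Finset.sum_le_sum fun T _ => ?_
          rw [← hsq]
          exact sum_advantage_close_le (by omega) (by linarith) hγε C hC A P hM0 hM1 T
      _ = _ := by
          rw [Finset.sum_const, Finset.card_univ, nsmul_eq_mul]
          ring
  have hfar : ∑ θ : Bits n, ∑ f : ι, ∑ T : Sample n t, ∑ x : Bits n,
        ∑ y with ¬ γ < relDist (onSample T x) (onSample T y) ∧ ¬ relDist x y ≤ γ + ε,
          advantage C M θ T f x (eveState A P θ x y)
      ≤ 2 ^ n * (Fintype.card ι * (Fintype.card (Sample n t) * Real.exp (-2 * ε ^ 2 * t))) := by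
    calc _ ≤ ∑ _θ : Bits n, ∑ _f : ι,
          Fintype.card (Sample n t) * Real.exp (-2 * ε ^ 2 * t) :=
          Finset.sum_le_sum fun θ _ => Finset.sum_le_sum fun f _ =>
            sum_advantage_far_le ht htn hε C A P hM0 hM1 θ f
      _ = _ := by
          simp only [Finset.sum_const, Finset.card_univ, nsmul_eq_mul, hB]
  have hsplit : ∑ θ : Bits n, ∑ T : Sample n t, ∑ f : ι, ∑ x : Bits n,
          ∑ y with ¬ γ < relDist (onSample T x) (onSample T y),
            advantage C M θ T f x (eveState A P θ x y)
      = (∑ T : Sample n t, ∑ θ : Bits n, ∑ f : ι, ∑ x : Bits n,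
        ∑ y with ¬ γ < relDist (onSample T x) (onSample T y) ∧ relDist x y ≤ γ + ε,
          advantage C M θ T f x (eveState A P θ x y))
        + ∑ θ : Bits n, ∑ f : ι, ∑ T : Sample n t, ∑ x : Bits n,
        ∑ y with ¬ γ < relDist (onSample T x) (onSample T y) ∧ ¬ relDist x y ≤ γ + ε,
          advantage C M θ T f x (eveState A P θ x y) := by
    rw [Finset.sum_comm (s := (Finset.univ : Finset (Sample n t))), ← Finset.sum_add_distrib]
    refine Finset.sum_congr rfl fun θ _ => ?_
    rw [Finset.sum_comm (s := (Finset.univ : Finset ι)), ← Finset.sum_add_distrib]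
    refine Finset.sum_congr rfl fun T _ => ?_
    rw [← Finset.sum_add_distrib]
    refine Finset.sum_congr rfl fun f _ => ?_
    rw [← Finset.sum_add_distrib]
    refine Finset.sum_congr rfl fun x _ => ?_
    rw [← Finset.sum_filter_add_sum_filter_not _ (fun y => relDist x y ≤ γ + ε),
      Finset.filter_filter, Finset.filter_filter]
  rw [hsplit, hB]
  have hexp : 0 ≤ Real.exp (-2 * ε ^ 2 * t) := (Real.exp_pos _).le
  calc _ ≤ ((2 ^ n : ℝ)⁻¹ * (Fintype.card (Sample n t) : ℝ)⁻¹ * (Fintype.card ι : ℝ)⁻¹) *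
        (Fintype.card (Sample n t) * (Fintype.card ι * (2 ^ n * R))
          + 2 ^ n * (Fintype.card ι * (Fintype.card (Sample n t) *
            Real.exp (-2 * ε ^ 2 * t)))) := by
        gcongr
    _ = Real.exp (-2 * ε ^ 2 * t) + R := by
        field_simp
        ring
    _ ≤ errorBound n t s l γ ε := by
        unfold errorBound
        linarith

end Protocol

/-! ### The noise threshold -/

lemma one_div_betaZero : 1 / betaZero = 4 - 2 * √2 := by
  have h : √(2 : ℝ) * √2 = 2 := Real.mul_self_sqrt (by norm_num)
  have h0 : √(2 : ℝ) ≠ 0 := by positivity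
  have hβ : betaZero ≠ 0 := by unfold betaZero; positivity
  rw [div_eq_iff hβ, betaZero]
  field_simp
  linear_combination 2 * h

lemma lt_one_div_betaZero : 1.1715 < 1 / betaZero := by
  have : √(2 : ℝ) < 1.41425 := (Real.sqrt_lt' (by norm_num)).2 (by norm_num)
  rw [one_div_betaZero]
  linarith

lemma one_div_betaZero_lt : 1 / betaZero < 1.1716 := by
  have : 1.4142 < √(2 : ℝ) := Real.lt_sqrt_of_sq_lt (by norm_num)
  rw [one_div_betaZero]
  linarith

lemma two_mul_binEnt_lt_iff (p : ℝ) : 2 * binEnt p < Real.logb 2 (1 / betaZero)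
    ↔ 2 * Real.binEntropy p < Real.log (1 / betaZero) := by
  rw [binEnt, Real.logb, ← mul_div_assoc, div_lt_div_iff_of_pos_right (Real.log_pos one_lt_two)]

lemma two_mul_binEntropy_lt : 2 * Real.binEntropy 0.015 < Real.log (1 / betaZero) := by
  have h1 : Real.log ((200 / 3) ^ 3 * (200 / 197) ^ 197) < Real.log (1.1715 ^ 100) :=
    Real.log_lt_log (by positivity) (by norm_num)
  rw [Real.log_mul (by positivity) (by positivity), Real.log_pow, Real.log_pow, Real.log_pow] at h1
  have h2 : Real.log 1.1715 < Real.log (1 / betaZero) :=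
    Real.log_lt_log (by norm_num) lt_one_div_betaZero
  rw [Real.binEntropy, show ((0.015 : ℝ)⁻¹) = 200 / 3 by norm_num,
    show ((1 - 0.015 : ℝ)⁻¹) = 200 / 197 by norm_num]
  push_cast at h1
  linarith

lemma lt_two_mul_binEntropy : Real.log (1 / betaZero) < 2 * Real.binEntropy (1 / 65) := by
  have h1 : Real.log (1.1716 ^ 65) < Real.log (65 ^ 2 * (65 / 64) ^ 128) :=
    Real.log_lt_log (by positivity) (by norm_num)
  rw [Real.log_mul (by positivity) (by positivity), Real.log_pow, Real.log_pow, Real.log_pow] at h1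
  have h2 : Real.log (1 / betaZero) < Real.log 1.1716 :=
    Real.log_lt_log (by linarith [lt_one_div_betaZero, show (0 : ℝ) < 1.1715 by norm_num])
      one_div_betaZero_lt
  rw [Real.binEntropy, show ((1 / 65 : ℝ)⁻¹) = 65 by norm_num,
    show ((1 - 1 / 65 : ℝ)⁻¹) = 65 / 64 by norm_num]
  push_cast at h1
  linarith

/-- The threshold lies between `0.015` and `1/65 < 0.0155`, a convenient point for comparing
rational powers. -/
lemma exists_noise_threshold : ∃ γ₀ : ℝ, 0.015 < γ₀ ∧ γ₀ < 0.0155 ∧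
    ∀ γ : ℝ, 0 ≤ γ → γ < 1 / 2 →
      (2 * binEnt γ < Real.logb 2 (1 / betaZero) ↔ γ < γ₀) := by
  obtain ⟨γ₀, ⟨h1, h2⟩, h3⟩ := intermediate_value_Ioo (a := (0.015 : ℝ)) (b := 1 / 65)
    (f := fun p => 2 * Real.binEntropy p) (by norm_num)
    (Real.binEntropy_continuous.const_mul 2 |>.continuousOn)
    ⟨two_mul_binEntropy_lt, lt_two_mul_binEntropy⟩
  refine ⟨γ₀, h1, h2.trans (by norm_num), fun γ hγ0 hγ1 => ?_⟩
  have hmem : γ ∈ Set.Icc (0 : ℝ) 2⁻¹ := ⟨hγ0, by linarith⟩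
  have hmem₀ : γ₀ ∈ Set.Icc (0 : ℝ) 2⁻¹ := by
    constructor <;> norm_num at h1 h2 ⊢ <;> linarith
  rw [two_mul_binEnt_lt_iff, ← h3, mul_lt_mul_iff_right₀ two_pos,
    Real.binEntropy_strictMonoOn.lt_iff_lt hmem hmem₀]

lemma superpolynomialDecay_exp_neg_mul {a : ℝ} (ha : 0 < a) :
    Asymptotics.SuperpolynomialDecay atTop (fun n : ℕ => (n : ℝ))
      (fun n : ℕ => Real.exp (-a * n)) := by
  intro k
  have h := tendsto_pow_const_mul_const_pow_of_abs_lt_one k (r := Real.exp (-a)) (by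
    rw [abs_of_pos (Real.exp_pos _)]
    exact Real.exp_lt_one_iff.2 (by linarith))
  refine h.congr fun n => ?_
  rw [← Real.exp_nat_mul, mul_comm (n : ℝ) (-a)]

/-- Below the noise threshold, syndromes at the Shannon limit leave a positive rate for the sample
and the key. A gap `g = log(1/β₀) - 2h(γ) > 0` is shared out: `g/8` each for the sample, the key, the
slack in the syndrome length and the change from `h(γ)` to `h(γ + ε)`, so that half of it remains
in the exponent. -/
lemma exists_asymptotic_parameters {γ : ℝ} (hγ0 : 0 ≤ γ) (hγ1 : γ < 1 / 4)
    (hγ : 2 * binEnt γ < Real.logb 2 (1 / betaZero)) (s : ℕ → ℕ)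
    (hs : Tendsto (fun n => (s n : ℝ) / n) atTop (𝓝 (binEnt γ))) :
    ∃ (ε r : ℝ) (t l : ℕ → ℕ), 0 < ε ∧ γ + ε ≤ 1 / 2 ∧ 0 < r ∧
      Asymptotics.SuperpolynomialDecay atTop (fun n : ℕ => (n : ℝ))
        (fun n => errorBound n (t n) (s n) (l n) γ ε) ∧
      ∀ᶠ n in atTop,
        0 < t n ∧ t n < n ∧ s n < n ∧ 0 < l n ∧ l n < n ∧ r * n ≤ l n := by
  set L := Real.logb 2 (1 / betaZero) with hL
  have hL1 : L < 1 := by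
    rw [hL, Real.logb_lt_iff_lt_rpow one_lt_two
      (by linarith [lt_one_div_betaZero, show (0 : ℝ) < 1.1715 by norm_num]), Real.rpow_one]
    linarith [one_div_betaZero_lt, show (1.1716 : ℝ) < 2 by norm_num]
  have hh0 : 0 ≤ binEnt γ :=
    div_nonneg (Real.binEntropy_nonneg hγ0 (by linarith)) (Real.log_pos one_lt_two).le
  set g := L - 2 * binEnt γ with hg
  have hg0 : 0 < g := by linarith
  have hg1 : g < 1 := by linarith
  have hcont : Continuous binEnt := Real.binEntropy_continuous.div_const _
  obtain ⟨ε₀, hε₀, hball⟩ := Metric.continuousAt_iff.1 (hcont.continuousAt (x := γ)) (g / 8)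
    (by linarith)
  set ε := min (ε₀ / 2) (1 / 4) with hε
  have hε0 : 0 < ε := by positivity
  have hεh : binEnt (γ + ε) < binEnt γ + g / 8 := by
    have h1 : dist (γ + ε) γ < ε₀ := by
      rw [Real.dist_eq, add_sub_cancel_left, abs_of_pos hε0]
      exact (min_le_left _ _).trans_lt (by linarith)
    have h2 := hball h1
    rw [Real.dist_eq, abs_lt] at h2
    linarith
  have hε1 : γ + ε ≤ 1 / 2 := by linarith [min_le_right (ε₀ / 2) (1 / 4 : ℝ)]
  set t : ℕ → ℕ := fun n => ⌊g / 8 * n⌋₊ + 1 with ht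
  have htlow : ∀ n : ℕ, g / 8 * n ≤ t n := by
    intro n
    rw [ht]
    push_cast
    exact (Nat.lt_floor_add_one _).le
  have htup : ∀ n : ℕ, (t n : ℝ) ≤ g / 8 * n + 1 := by
    intro n
    rw [ht]
    push_cast
    linarith [Nat.floor_le (show 0 ≤ g / 8 * (n : ℝ) by positivity)]
  have hsup : ∀ᶠ n in atTop, (s n : ℝ) ≤ (binEnt γ + g / 8) * n := by
    filter_upwards [hs.eventually_lt_const (show binEnt γ < binEnt γ + g / 8 by linarith),
      eventually_gt_atTop 0] with n hn hn0
    rw [div_lt_iff₀ (by exact_mod_cast hn0)] at hn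
    exact hn.le
  refine ⟨ε, g / 8, t, t, hε0, hε1, by linarith, ?_, ?_⟩
  · have ha : 0 < 2 * ε ^ 2 * (g / 8) := by positivity
    have hb : 0 < Real.log 2 * (g / 4) := mul_pos (Real.log_pos one_lt_two) (by linarith)
    have hdecay := ((superpolynomialDecay_exp_neg_mul ha).const_mul 5).add
      (superpolynomialDecay_exp_neg_mul hb)
    refine hdecay.trans_eventually_abs_le ?_
    filter_upwards [hsup] with n hn
    have hE0 : 0 ≤ errorBound n (t n) (s n) (t n) γ ε := by unfold errorBound; positivity
    simp only [Function.comp_apply, Pi.add_apply]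
    rw [abs_of_nonneg hE0, abs_of_nonneg (by positivity), errorBound]
    refine add_le_add ?_ ?_
    · refine mul_le_mul_of_nonneg_left (Real.exp_le_exp.2 ?_) (by norm_num)
      have h1 := mul_le_mul_of_nonneg_left (htlow n) (show 0 ≤ 2 * ε ^ 2 by positivity)
      linarith
    · have e1 : -(Real.log 2 * (g / 4)) * (n : ℝ) = Real.log 2 * -(g / 4 * n) := by ring
      rw [Real.rpow_def_of_pos two_pos, Real.exp_le_exp, e1]
      refine mul_le_mul_of_nonneg_left ?_ (Real.log_pos one_lt_two).le
      have h1 : binEnt (γ + ε) * n ≤ (binEnt γ + g / 8) * n :=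
        mul_le_mul_of_nonneg_right hεh.le (Nat.cast_nonneg n)
      have h2 := htup n
      have h3 : L * n = g * n + 2 * binEnt γ * n := by rw [hg]; ring
      have h4 : -(1 / 2 : ℝ) * (L * n - binEnt (γ + ε) * n - t n - t n - s n + 2)
          ≤ -(g / 4 * n) := by linarith
      exact h4
  · filter_upwards [hsup, eventually_ge_atTop 2] with n hn hn2
    have hn2' : (2 : ℝ) ≤ n := by exact_mod_cast hn2
    have htn : t n < n := by
      have h1 := htup n
      have : (t n : ℝ) < n := by nlinarith
      exact_mod_cast this
    have hsn : s n < n := by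
      have : (s n : ℝ) < n := by nlinarith
      exact_mod_cast this
    exact ⟨Nat.succ_pos _, htn, hsn, Nat.succ_pos _, htn, htlow n⟩

end EQKD

end

theorem mainTheorem3 :
    -- security for all finite sizes
    (∀ (n t s l : ℕ) (γ ε : ℝ),
      0 < t → t < n → 0 < s → s < n → 0 < l → l < n → 0 ≤ γ → γ < 1 / 2 →
      0 < ε → γ + ε ≤ 1 / 2 →
      EQKD.OneSidedSecure n t s l γ (EQKD.errorBound n t s l γ ε)) ∧
    -- asymptotically tolerable noise
    (∃ γ₀ : ℝ, 0.015 < γ₀ ∧ γ₀ < 0.0155 ∧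
      (∀ γ : ℝ, 0 ≤ γ → γ < 1 / 2 →
        (2 * EQKD.binEnt γ < Real.logb 2 (1 / EQKD.betaZero) ↔ γ < γ₀)) ∧
      ∀ γ : ℝ, 0 ≤ γ → γ < γ₀ →
        ∀ s : ℕ → ℕ, (∀ᶠ n in atTop, 0 < s n) →
          Tendsto (fun n => (s n : ℝ) / n) atTop (𝓝 (EQKD.binEnt γ)) →
          ∃ (ε r : ℝ) (t l : ℕ → ℕ), 0 < ε ∧ γ + ε ≤ 1 / 2 ∧ 0 < r ∧
            Asymptotics.SuperpolynomialDecay atTop (fun n : ℕ => (n : ℝ))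
              (fun n => EQKD.errorBound n (t n) (s n) (l n) γ ε) ∧
            ∀ᶠ n in atTop,
              0 < t n ∧ t n < n ∧ s n < n ∧ 0 < l n ∧ l n < n ∧ r * n ≤ l n ∧
              EQKD.OneSidedSecure n (t n) (s n) (l n) γ
                (EQKD.errorBound n (t n) (s n) (l n) γ ε)) := by
  refine ⟨fun n t s l γ ε ht htn _ _ _ _ hγ _ hε hγε =>
    EQKD.oneSidedSecure_errorBound ht htn hγ hε hγε, ?_⟩
  obtain ⟨γ₀, h1, h2, hiff⟩ := EQKD.exists_noise_threshold
  refine ⟨γ₀, h1, h2, hiff, fun γ hγ0 hγ s _ hs => ?_⟩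
  have hγ1 : γ < 1 / 4 := by
    have : (0.0155 : ℝ) < 1 / 4 := by norm_num
    linarith
  obtain ⟨ε, r, t, l, hε, hγε, hr, hdecay, hev⟩ := EQKD.exists_asymptotic_parameters hγ0 hγ1
    ((hiff γ hγ0 (by linarith)).2 hγ) s hs
  refine ⟨ε, r, t, l, hε, hγε, hr, hdecay, hev.mono ?_⟩
  rintro n ⟨ht, htn, hsn, hl, hln, hrl⟩
  exact ⟨ht, htn, hsn, hl, hln, hrl, EQKD.oneSidedSecure_errorBound ht htn hγ0 hε hγε⟩
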